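/- **Setting.** Let $f:\mathbb R^d\times\mathbb R^d\to\mathbb R^d$ be Lipschitz continuous and let $(x,v)$ solve $\dot x=v$, $\dot v=f(x,v)$ on $[t_0,T]$, $t_0<T$. Let $0\le e_1<\dots<e_M\le 1$ be nodes with Lagrange polynomials $l_j$, put $q_{m,j}=\int_0^{e_m}l_j$, $q_j=\int_0^1 l_j$, and let $p\ge 1$ be the order of the quadrature rule $(q_j,e_j)$ on $[0,1]$, i.e. it integrates polynomials of degree $<p$ exactly (e.g. $p=2M$ for Gauss–Legendre nodes). Let $Q\in\mathbb R^{(M+1)\times(M+1)}$ have zero first row and column and entries $q_{m,j}$ otherwise, let $q=(0,q_1,\dots,q_M)$, and, with $e_0=0$ and $\delta_l=e_l-e_{l-1}$, let (indices $0,\dots,M$) $(Q_E)_{m,l}=\delta_{l+1}$ for $l<m$, $(Q_I)_{m,l}=\delta_l$ for $1\le l\le m$, all other entries zero, $Q_T=\tfrac12(Q_E+Q_I)$, $Q_x=Q_EQ_T+\tfrac12 Q_E\circ Q_E$ ($\circ$ the entrywise product). Matrices act on vectors of node values $X=(X_0,\dots,X_M)\in(\mathbb R^d)^{M+1}$ as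 $A\otimes I_d$; $F(X,V)=(f(X_m,V_m))_{m}$; a single vector of $\mathbb R^d$ in place of such a vector is repeated $M+1$ times. For a step size $h>0$ and values $(x_n,v_n)$ at the beginning of a time step, the collocation solution $(X,V)$ satisfies $X=x_n+hQv_n+h^2QQF(X,V)$, $V=v_n+hQF(X,V)$. Second-order SDC with $k$ iterations starts from node values $(X^0,V^0)$, produced by some starting procedure (which may depend on $h$, $n$, $x_n$, $v_n$), and determines $(X^{i+1},V^{i+1})$, $0\le i<k$, by $$X^{i+1}-h^2Q_xF(X^{i+1},V^{i+1})=x_n+hQv_n+h^2(QQ-Q_x)F(X^i,V^i),$$ $$V^{i+1}-hQ_TF(X^{i+1},V^{i+1})=v_n+h(Q-Q_T)F(X^i,V^i),$$ and then sets $x_{n+1}=x_n+h\,q\,v_n+h^2\,qQ\,F(X^k,V^k)$, $v_{n+1}=v_n+h\,q\,F(X^k,V^k)$. The starting procedure has order $k_0\ge0$ if for every bounded set of values $(x_n,v_n)$ there is a constant $C_0$ such that $\|X-X^0\|\le C_0h^{k_0}$ and $\|V-V^0\|\le C_0h^{k_0}$ for all sufficiently small $h$, where $(X,V)$ is the collocation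 solution. **Theorem.** Assume that $t\mapsto f(x(t),v(t))$ is $p$ times continuously differentiable on $[t_0,T]$ and, if $p>M+1$, that moreover $f$ is $p$ times continuously differentiable in a neighbourhood of the curve $\{(x(t),v(t)):t\in[t_0,T]\}$. Let the starting procedure have order $k_0$, with $k+k_0\ge1$. Then SDC with $k$ iterations per step, started at $(x_0,v_0)=(x(t_0),v(t_0))$, converges globally with order $p^*=\min\{p,k+k_0\}$: there are $C$ and $h_0>0$ such that for all $0<h\le h_0$ the numerical solution $(x_n,v_n)_{n\ge0}$ exists, is unique, and satisfies $$|x(t_0+nh)-x_n|\le C h^{p^*},\qquad |v(t_0+nh)-v_n|\le C h^{p^*}\qquad\text{for all } n \text{ with } t_0+nh\le T.$$ If $f$ does not depend on $v$, the same holds with $p^*=\min\{p,2k+k_0\}$. -/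

import Mathlib

namespace SDC

/-- Positions and velocities live in `ℝ^d` with the Euclidean norm. -/
abbrev Vec (d : ℕ) := EuclideanSpace ℝ (Fin d)

noncomputable section

/-- `∫_0^b l_j(s) ds`, where `l_j` is the Lagrange polynomial of the nodes `e_1, …, e_M`. -/
def weight {M : ℕ} (e : Fin M → ℝ) (b : ℝ) (j : Fin M) : ℝ :=
  ∫ s in (0 : ℝ)..b, (Lagrange.basis Finset.univ e j).eval s

/-- The row vector `q = (0, q_1, …, q_M)` with `q_j = ∫_0^1 l_j`. -/
def q {M : ℕ} (e : Fin M → ℝ) : Fin (M + 1) → ℝ :=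
  Fin.cons 0 (weight e 1)

/-- The interpolatory quadrature rule on `[0,1]` with nodes `e` has order (at least) `p`: it
integrates all polynomials of degree `< p` exactly. -/
def QuadratureOrder {M : ℕ} (e : Fin M → ℝ) (p : ℕ) : Prop :=
  ∀ P : Polynomial ℝ, P.degree < (p : WithBot ℕ) →
    ∑ j, weight e 1 j * P.eval (e j) = ∫ s in (0 : ℝ)..1, P.eval s

/-- The collocation matrix `Q`: first row and column are zero, the remaining entries are
`q_{m,j} = ∫_0^{e_m} l_j`. -/
def Q {M : ℕ} (e : Fin M → ℝ) : Matrix (Fin (M + 1)) (Fin (M + 1)) ℝ :=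
  Matrix.of (Fin.cons 0 fun m => Fin.cons 0 fun j => weight e (e m) j)

/-- Normalized distances `Δτ_{m+1} / Δt` between consecutive nodes, where `τ_0 = t_n`. -/
def gap {M : ℕ} (e : Fin M → ℝ) (m : Fin M) : ℝ :=
  (Fin.cons 0 e : Fin (M + 1) → ℝ) m.succ - (Fin.cons 0 e : Fin (M + 1) → ℝ) m.castSucc

/-- Explicit Euler matrix: row `m` is `(Δτ_1, …, Δτ_m, 0, …, 0) / Δt`. -/
def QE {M : ℕ} (e : Fin M → ℝ) : Matrix (Fin (M + 1)) (Fin (M + 1)) ℝ :=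
  Matrix.of fun m l => if l < m then (Fin.snoc (gap e) 0 : Fin (M + 1) → ℝ) l else 0

/-- Implicit Euler matrix: row `m` is `(0, Δτ_1, …, Δτ_m, 0, …, 0) / Δt`. -/
def QI {M : ℕ} (e : Fin M → ℝ) : Matrix (Fin (M + 1)) (Fin (M + 1)) ℝ :=
  Matrix.of fun m l => if l ≤ m then (Fin.cons 0 (gap e) : Fin (M + 1) → ℝ) l else 0

/-- Trapezoidal matrix `Q_T`. -/
def QT {M : ℕ} (e : Fin M → ℝ) : Matrix (Fin (M + 1)) (Fin (M + 1)) ℝ :=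
  (1 / 2 : ℝ) • (QE e + QI e)

/-- The matrix `Q_x` of the velocity-Verlet position update. -/
def Qx {M : ℕ} (e : Fin M → ℝ) : Matrix (Fin (M + 1)) (Fin (M + 1)) ℝ :=
  QE e * QT e + (1 / 2 : ℝ) • Matrix.hadamard (QE e) (QE e)

/-- The action of `A ⊗ I_d` on a vector of node values. -/
def act {n d : ℕ} (A : Matrix (Fin n) (Fin n) ℝ) (W : Fin n → Vec d) : Fin n → Vec d :=
  fun m => ∑ l, A m l • W l

/-- The vector `F(X, V)` of the forces at all nodes. -/
def force {n d : ℕ} (f : Vec d × Vec d → Vec d) (X V : Fin n → Vec d) : Fin n → Vec d :=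
  fun m => f (X m, V m)

/-- `(X, V)` solves the collocation problem with step size `h` and initial values `x₀, v₀`. -/
def IsCollocationSolution {M d : ℕ} (e : Fin M → ℝ) (f : Vec d × Vec d → Vec d) (h : ℝ)
    (x₀ v₀ : Vec d) (X V : Fin (M + 1) → Vec d) : Prop :=
  X = (fun _ => x₀) + h • act (Q e) (fun _ => v₀) + h ^ 2 • act (Q e * Q e) (force f X V) ∧
  V = (fun _ => v₀) + h • act (Q e) (force f X V)

/-- One SDC iteration, from the node values `(X, V)` to the node values `(X', V')`. -/
def IsSweep {M d : ℕ} (e : Fin M → ℝ) (f : Vec d × Vec d → Vec d) (h : ℝ)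
    (x₀ v₀ : Vec d) (X V X' V' : Fin (M + 1) → Vec d) : Prop :=
  X' - h ^ 2 • act (Qx e) (force f X' V') =
    (fun _ => x₀) + h • act (Q e) (fun _ => v₀) + h ^ 2 • act (Q e * Q e - Qx e) (force f X V) ∧
  V' - h • act (QT e) (force f X' V') =
    (fun _ => v₀) + h • act (Q e - QT e) (force f X V)

/-- One time step of SDC with `k` iterations started from the node values `(X₀, V₀)`: it takes
`(x₀, v₀)` at the beginning of the time step to `(x₁, v₁)` at its end. -/
def IsStep {M d : ℕ} (e : Fin M → ℝ) (f : Vec d × Vec d → Vec d) (k : ℕ) (h : ℝ)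
    (X₀ V₀ : Fin (M + 1) → Vec d) (x₀ v₀ x₁ v₁ : Vec d) : Prop :=
  ∃ X V : ℕ → Fin (M + 1) → Vec d,
    X 0 = X₀ ∧ V 0 = V₀ ∧
    (∀ i < k, IsSweep e f h x₀ v₀ (X i) (V i) (X (i + 1)) (V (i + 1))) ∧
    x₁ = x₀ + h • ∑ m, q e m • v₀ + h ^ 2 • ∑ m, (Matrix.vecMul (q e) (Q e)) m • f (X k m, V k m) ∧
    v₁ = v₀ + h • ∑ m, q e m • f (X k m, V k m)

/-- A procedure for generating the starting value `U⁰ = (X⁰, V⁰)` of the iteration: it may depend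
on the step size, on the number of the time step and on the values at the beginning of the
step. -/
abbrev Starter (M d : ℕ) :=
  ℝ → ℕ → Vec d → Vec d → (Fin (M + 1) → Vec d) × (Fin (M + 1) → Vec d)

/-- The starting procedure has order `k₀`: `‖X - X⁰‖ ≤ C₀ Δt^k₀` and `‖V - V⁰‖ ≤ C₀ Δt^k₀` for the
collocation solution `(X, V)`, for all small `Δt`, where `C₀` does not depend on `Δt` and is locally
uniform in the values at the beginning of the time step. -/
def StarterOrder {M d : ℕ} (e : Fin M → ℝ) (f : Vec d × Vec d → Vec d) (S : Starter M d)
    (k₀ : ℕ) : Prop :=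
  ∀ R : ℝ, ∃ C₀ h₀ : ℝ, 0 < h₀ ∧ ∀ h, 0 < h → h ≤ h₀ → ∀ (n : ℕ) (x₀ v₀ : Vec d),
    ‖x₀‖ ≤ R → ‖v₀‖ ≤ R → ∀ X V, IsCollocationSolution e f h x₀ v₀ X V →
      ∀ m, ‖X m - (S h n x₀ v₀).1 m‖ ≤ C₀ * h ^ k₀ ∧ ‖V m - (S h n x₀ v₀).2 m‖ ≤ C₀ * h ^ k₀

/-- `u n = (x_n, v_n)` is the numerical solution produced by SDC with `k` iterations per time step,
constant step size `h` and initial values `x₀, v₀`. -/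
def IsRun {M d : ℕ} (e : Fin M → ℝ) (f : Vec d × Vec d → Vec d) (k : ℕ) (S : Starter M d)
    (h : ℝ) (x₀ v₀ : Vec d) (u : ℕ → Vec d × Vec d) : Prop :=
  u 0 = (x₀, v₀) ∧ ∀ n, IsStep e f k h (S h n (u n).1 (u n).2).1 (S h n (u n).1 (u n).2).2
    (u n).1 (u n).2 (u (n + 1)).1 (u (n + 1)).2

/-- `(x, v)` solves `x' = v`, `v' = f(x, v)` on `[t₀, T]`. -/
def IsSolution {d : ℕ} (f : Vec d × Vec d → Vec d) (t₀ T : ℝ) (x v : ℝ → Vec d) : Prop :=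
  ∀ t ∈ Set.Icc t₀ T, HasDerivWithinAt x (v t) (Set.Icc t₀ T) t ∧
    HasDerivWithinAt v (f (x t, v t)) (Set.Icc t₀ T) t

/-- SDC with `k` iterations converges globally with order `r` to `(x, v)` on `[t₀, T]`: for all
sufficiently small step sizes the method is well defined and the errors of position and velocity
at all grid points are at most `C * h ^ r`. -/
def ConvergesWithOrder {M d : ℕ} (e : Fin M → ℝ) (f : Vec d × Vec d → Vec d) (k : ℕ)
    (S : Starter M d) (t₀ T : ℝ) (x v : ℝ → Vec d) (r : ℕ) : Prop :=
  ∃ C h₀ : ℝ, 0 < h₀ ∧ ∀ h, 0 < h → h ≤ h₀ →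
    (∃! u, IsRun e f k S h (x t₀) (v t₀) u) ∧
    ∀ u, IsRun e f k S h (x t₀) (v t₀) u → ∀ n : ℕ, t₀ + n * h ≤ T →
      ‖x (t₀ + n * h) - (u n).1‖ ≤ C * h ^ r ∧ ‖v (t₀ + n * h) - (u n).2‖ ≤ C * h ^ r

end

end SDC

/-! The collocation solution is a fixed point of the SDC sweep, and a sweep shrinks the distance to
it by a factor `O(h)`, since the forces enter the sweep equations multiplied by `h` or `h ^ 2`. If
`f` ignores the velocity, the position equation closes on its own and the factor is `O(h ^ 2)`.
After `k` sweeps the forces at the nodes therefore agree with those of collocation up to `O(h ^ s)`,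
with `s = k + k₀` or `s = 2 * k + k₀` (`StarterOrder.forceOrder`,
`StarterOrder.forceOrder_of_indep`), and the final update multiplies this by another `h`. A
collocation step from the solution curve has error `O(h ^ (p + 1))` (`collocation_local_error`).
Since the collocation step is Lipschitz with constant `1 + O(h)`, `discrete_gronwall` adds up the
local errors.

The substantial point is the superconvergence of collocation. Eliminating the position equation
turns the scheme into ordinary collocation for `u' = G(u)` with `u = (x, v)`. Let `η` be the
collocation polynomial minus the solution, in the rescaled time `s ∈ [0, 1]`. It satisfies `η' = h
(J η + δ)` with `J = G'(u)`, and at the nodes the defect `δ` is just the quadratic Taylor remainder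
of `G`, of size `O(h ^ (2 (M + 1)))`, which suffices because `p ≤ 2 M`. By variation of constants `η
1 = h ∫ B δ` with a backward resolvent `B`. The quadrature rule applied to `B δ` sees only the
nodes, so the integral is as small as the quadrature error (`bigO_of_small_defect`). For `p ≤ M + 1`
no linearization is needed and the Lipschitz property is enough.

Quadrature errors are usually bounded by derivatives. Here derivatives are replaced by `Jet`:
polynomials in `h s` with bounded coefficients plus a continuous `O(h ^ r)` remainder, uniformly
over a family of steps. This class is stable under products, integration and interpolation, and a
rule of order `r` integrates it up to `O(h ^ r)`. -/

open Set

namespace SDC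

/-! ### Calculus of uniform expansions in powers of the step size -/

section Jets

set_option linter.unusedSectionVars false

variable {ι E F G : Type*} [NormedAddCommGroup E] [NormedSpace ℝ E]
  [NormedAddCommGroup F] [NormedSpace ℝ F] [NormedAddCommGroup G] [NormedSpace ℝ G]
  {h : ι → ℝ} {r : ℕ}

/-- The family `φ` of functions on `[0, 1]` is `O(h ^ r)`, uniformly. -/
def BigO (h : ι → ℝ) (r : ℕ) (φ : ι → ℝ → E) : Prop :=
  ∃ C : ℝ, ∀ i, ∀ s ∈ Icc (0 : ℝ) 1, ‖φ i s‖ ≤ C * h i ^ r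

theorem BigO.exists_nonneg (hh : ∀ i, h i ∈ Ioc (0 : ℝ) 1) {φ : ι → ℝ → E} (hφ : BigO h r φ) :
    ∃ C : ℝ, 0 ≤ C ∧ ∀ i, ∀ s ∈ Icc (0 : ℝ) 1, ‖φ i s‖ ≤ C * h i ^ r := by
  obtain ⟨C, hC⟩ := hφ
  refine ⟨|C|, abs_nonneg C, fun i s hs => (hC i s hs).trans ?_⟩
  have := (hh i).1
  gcongr
  exact le_abs_self C

theorem BigO.of_le (hh : ∀ i, h i ∈ Ioc (0 : ℝ) 1) {φ : ι → ℝ → E} (hφ : BigO h r φ) {r' : ℕ}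
    (hr : r' ≤ r) : BigO h r' φ := by
  obtain ⟨C, hC0, hC⟩ := hφ.exists_nonneg hh
  refine ⟨C, fun i s hs => (hC i s hs).trans ?_⟩
  exact mul_le_mul_of_nonneg_left (pow_le_pow_of_le_one (hh i).1.le (hh i).2 hr) hC0

theorem BigO.congr {φ ψ : ι → ℝ → E} (hφ : BigO h r φ)
    (he : ∀ i, ∀ s ∈ Icc (0 : ℝ) 1, ψ i s = φ i s) : BigO h r ψ := by
  obtain ⟨C, hC⟩ := hφ
  exact ⟨C, fun i s hs => by rw [he i s hs]; exact hC i s hs⟩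

theorem BigO.add {φ ψ : ι → ℝ → E} (hφ : BigO h r φ) (hψ : BigO h r ψ) :
    BigO h r (φ + ψ) := by
  obtain ⟨C, hC⟩ := hφ
  obtain ⟨D, hD⟩ := hψ
  refine ⟨C + D, fun i s hs => (norm_add_le _ _).trans ?_⟩
  rw [add_mul]
  exact add_le_add (hC i s hs) (hD i s hs)

theorem BigO.neg {φ : ι → ℝ → E} (hφ : BigO h r φ) : BigO h r (-φ) := by
  obtain ⟨C, hC⟩ := hφ
  exact ⟨C, fun i s hs => by simpa using hC i s hs⟩

theorem BigO.sub {φ ψ : ι → ℝ → E} (hφ : BigO h r φ) (hψ : BigO h r ψ) :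
    BigO h r (φ - ψ) := by
  rw [sub_eq_add_neg]
  exact hφ.add hψ.neg

theorem BigO.sum {κ : Type*} (s : Finset κ) {φ : κ → ι → ℝ → E}
    (hφ : ∀ j ∈ s, BigO h r (φ j)) : BigO h r (fun i t => ∑ j ∈ s, φ j i t) := by
  classical
  induction s using Finset.induction_on with
  | empty => exact ⟨0, by simp⟩
  | insert j s hj ih =>
    refine ((hφ j (by simp)).add (ih fun k hk => hφ k (by simp [hk]))).congr ?_
    intro i t _
    simp [Finset.sum_insert hj]

theorem BigO.bilin (hh : ∀ i, h i ∈ Ioc (0 : ℝ) 1) (L : E →L[ℝ] F →L[ℝ] G) {r' : ℕ}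
    {φ : ι → ℝ → E} {ψ : ι → ℝ → F} (hφ : BigO h r φ) (hψ : BigO h r' ψ) :
    BigO h (r + r') (fun i s => L (φ i s) (ψ i s)) := by
  obtain ⟨C, hC0, hC⟩ := hφ.exists_nonneg hh
  obtain ⟨D, hD0, hD⟩ := hψ.exists_nonneg hh
  refine ⟨‖L‖ * C * D, fun i s hs => (L.le_opNorm₂ _ _).trans ?_⟩
  have := (hh i).1
  calc ‖L‖ * ‖φ i s‖ * ‖ψ i s‖ ≤ ‖L‖ * (C * h i ^ r) * (D * h i ^ r') := by
        gcongr
        · exact hC i s hs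
        · exact hD i s hs
    _ = _ := by ring

theorem BigO.smul_step {φ : ι → ℝ → E} (hh : ∀ i, h i ∈ Ioc (0 : ℝ) 1) (hφ : BigO h r φ) :
    BigO h (r + 1) (fun i s => h i • φ i s) := by
  obtain ⟨C, hC⟩ := hφ
  refine ⟨C, fun i s hs => ?_⟩
  rw [norm_smul, Real.norm_of_nonneg (hh i).1.le, pow_succ]
  nlinarith [hC i s hs, (hh i).1]

theorem BigO.integral {φ : ι → ℝ → E} (hh : ∀ i, h i ∈ Ioc (0 : ℝ) 1) (hφ : BigO h r φ) :
    BigO h r (fun i s => ∫ σ in (0 : ℝ)..s, φ i σ) := by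
  obtain ⟨C, hC0, hC⟩ := hφ.exists_nonneg hh
  refine ⟨C, fun i s hs => ?_⟩
  have hb : ∀ σ ∈ uIoc (0 : ℝ) s, ‖φ i σ‖ ≤ C * h i ^ r := by
    intro σ hσ
    rw [uIoc_of_le hs.1] at hσ
    exact hC i σ ⟨hσ.1.le, hσ.2.trans hs.2⟩
  refine (intervalIntegral.norm_integral_le_of_norm_le_const hb).trans ?_
  have := (hh i).1
  rw [sub_zero, abs_of_nonneg hs.1]
  exact mul_le_of_le_one_right (by positivity) hs.2

theorem BigO.at {φ : ι → ℝ → E} (hφ : BigO h r φ) {t : ℝ} (ht : t ∈ Icc (0 : ℝ) 1) :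
    BigO h r (fun i _ => φ i t) := by
  obtain ⟨C, hC⟩ := hφ
  exact ⟨C, fun i _ _ => hC i t ht⟩

/-- Families of functions on `[0, 1]` which are polynomials in `h s` with bounded coefficients, up
to an error `O(h ^ r)`. -/
inductive Jet (h : ι → ℝ) (r : ℕ) : (ι → ℝ → E) → Prop
  | monomial (k : ℕ) (a : ι → E) (ha : ∃ C : ℝ, ∀ i, ‖a i‖ ≤ C) :
      Jet h r fun i s => (h i * s) ^ k • a i
  | small (φ : ι → ℝ → E) (hc : ∀ i, ContinuousOn (φ i) (Icc 0 1)) (hb : BigO h r φ) : Jet h r φ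
  | add (φ ψ : ι → ℝ → E) (hφ : Jet h r φ) (hψ : Jet h r ψ) : Jet h r (φ + ψ)
  | congr (φ ψ : ι → ℝ → E) (hφ : Jet h r φ) (he : ∀ i, ∀ s ∈ Icc (0 : ℝ) 1, ψ i s = φ i s) :
      Jet h r ψ

theorem Jet.continuousOn {φ : ι → ℝ → E} (hφ : Jet h r φ) (i : ι) :
    ContinuousOn (φ i) (Icc 0 1) := by
  induction hφ with
  | monomial k a ha => exact Continuous.continuousOn (by fun_prop)
  | small φ hc hb => exact hc i
  | add φ ψ _ _ h1 h2 => exact h1.add h2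
  | congr φ ψ _ he h1 => exact h1.congr (he i)

theorem Jet.intervalIntegrable {φ : ι → ℝ → E} (hφ : Jet h r φ) (i : ι) {a b : ℝ}
    (ha : a ∈ Icc (0 : ℝ) 1) (hb : b ∈ Icc (0 : ℝ) 1) :
    IntervalIntegrable (φ i) MeasureTheory.volume a b :=
  ((hφ.continuousOn i).mono (uIcc_subset_Icc ha hb)).intervalIntegrable

theorem bigO_monomial (hh : ∀ i, h i ∈ Ioc (0 : ℝ) 1) (k : ℕ) {a : ι → E}
    (ha : ∃ C : ℝ, ∀ i, ‖a i‖ ≤ C) : BigO h k (fun i s => (h i * s) ^ k • a i) := by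
  obtain ⟨C, hC⟩ := ha
  refine ⟨C, fun i s hs => ?_⟩
  have h1 := (hh i).1
  have h0 := hs.1
  rw [norm_smul, Real.norm_of_nonneg (by positivity), mul_comm]
  have : 0 ≤ C := (norm_nonneg _).trans (hC i)
  gcongr
  · exact hC i
  · exact mul_le_of_le_one_right h1.le hs.2

theorem Jet.bigO (hh : ∀ i, h i ∈ Ioc (0 : ℝ) 1) {φ : ι → ℝ → E} (hφ : Jet h r φ) :
    BigO h 0 φ := by
  induction hφ with
  | monomial k a ha => exact (bigO_monomial hh k ha).of_le hh (Nat.zero_le _)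
  | small φ hc hb => exact hb.of_le hh (Nat.zero_le _)
  | add φ ψ _ _ h1 h2 => exact h1.add h2
  | congr φ ψ _ he h1 => exact h1.congr he

theorem Jet.of_le (hh : ∀ i, h i ∈ Ioc (0 : ℝ) 1) {φ : ι → ℝ → E} (hφ : Jet h r φ) {r' : ℕ}
    (hr : r' ≤ r) : Jet h r' φ := by
  induction hφ with
  | monomial k a ha => exact .monomial k a ha
  | small φ hc hb => exact .small φ hc (hb.of_le hh hr)
  | add φ ψ _ _ h1 h2 => exact .add _ _ h1 h2
  | congr φ ψ _ he h1 => exact .congr _ _ h1 he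

theorem Jet.const {a : ι → E} (ha : ∃ C : ℝ, ∀ i, ‖a i‖ ≤ C) : Jet h r (fun i _ => a i) :=
  .congr _ _ (.monomial 0 a ha) (by simp)

theorem Jet.neg {φ : ι → ℝ → E} (hφ : Jet h r φ) : Jet h r (-φ) := by
  induction hφ with
  | monomial k a ha =>
    refine .congr _ _ (.monomial k (-a) (by simpa using ha)) ?_
    simp
  | small φ hc hb => exact .small _ (fun i => (hc i).neg) hb.neg
  | add φ ψ _ _ h1 h2 =>
    rw [neg_add]
    exact .add _ _ h1 h2
  | congr φ ψ _ he h1 => exact .congr _ _ h1 (by simpa using he)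

theorem Jet.sub {φ ψ : ι → ℝ → E} (hφ : Jet h r φ) (hψ : Jet h r ψ) : Jet h r (φ - ψ) := by
  rw [sub_eq_add_neg]
  exact .add _ _ hφ hψ.neg

theorem Jet.sum {κ : Type*} (s : Finset κ) {φ : κ → ι → ℝ → E}
    (hφ : ∀ j ∈ s, Jet h r (φ j)) : Jet h r (fun i t => ∑ j ∈ s, φ j i t) := by
  classical
  induction s using Finset.induction_on with
  | empty => exact .small _ (by simp [continuousOn_const]) ⟨0, by simp⟩
  | insert j s hj ih =>
    refine .congr _ _ (.add _ _ (hφ j (by simp)) (ih fun k hk => hφ k (by simp [hk]))) ?_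
    intro i t _
    simp [Finset.sum_insert hj]

theorem continuousOn_bilin (L : E →L[ℝ] F →L[ℝ] G) {φ : ℝ → E} {ψ : ℝ → F}
    {s : Set ℝ} (hφ : ContinuousOn φ s) (hψ : ContinuousOn ψ s) :
    ContinuousOn (fun t => L (φ t) (ψ t)) s :=
  (L.continuous.comp_continuousOn hφ).clm_apply hψ

/-- Monomials of any degree are allowed, so products need no truncation; a remainder stays a
remainder when multiplied by a bounded factor. -/
theorem Jet.bilin (hh : ∀ i, h i ∈ Ioc (0 : ℝ) 1) (L : E →L[ℝ] F →L[ℝ] G)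
    {φ : ι → ℝ → E} {ψ : ι → ℝ → F} (hφ : Jet h r φ) (hψ : Jet h r ψ) :
    Jet h r (fun i s => L (φ i s) (ψ i s)) := by
  induction hφ with
  | monomial k a ha =>
    induction hψ with
    | monomial l b hb =>
      refine .congr _ _ (.monomial (k + l) (fun i => L (a i) (b i)) ?_) ?_
      · obtain ⟨C, hC⟩ := ha
        obtain ⟨D, hD⟩ := hb
        refine ⟨‖L‖ * C * D, fun i => (L.le_opNorm₂ _ _).trans ?_⟩
        have : 0 ≤ C := (norm_nonneg _).trans (hC i)
        gcongr
        · exact hC i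
        · exact hD i
      · intro i s _
        simp only [map_smul, smul_apply, smul_smul, pow_add]
        rw [mul_comm]
    | small ψ hc hb =>
      refine .small _ (fun i => continuousOn_bilin L (Continuous.continuousOn (by fun_prop))
        (hc i)) ?_
      have := ((bigO_monomial hh k ha).of_le hh (Nat.zero_le _)).bilin hh L hb
      rwa [zero_add] at this
    | add ψ χ _ _ h1 h2 => exact .congr _ _ (.add _ _ h1 h2) (by simp)
    | congr ψ χ _ he h1 => exact .congr _ _ h1 fun i s hs => by rw [he i s hs]
  | small φ hc hb =>
    refine .small _ (fun i => continuousOn_bilin L (hc i) (hψ.continuousOn i)) ?_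
    exact hb.bilin hh L (hψ.bigO hh)
  | add φ χ _ _ h1 h2 => exact .congr _ _ (.add _ _ h1 h2) (by simp)
  | congr φ χ _ he h1 => exact .congr _ _ h1 fun i s hs => by rw [he i s hs]

/-- Only the `O(h ^ r)` remainder of `φ` is one order short, and it is multiplied by `ψ = O(h)`.
This compensates for the derivative lost in passing from `G` to its Jacobian. -/
theorem Jet.bilin_of_bigO_one (hh : ∀ i, h i ∈ Ioc (0 : ℝ) 1) (L : E →L[ℝ] F →L[ℝ] G)
    {φ : ι → ℝ → E} {ψ : ι → ℝ → F} (hφ : Jet h r φ) (hψ : Jet h (r + 1) ψ)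
    (hψ1 : BigO h 1 ψ) : Jet h (r + 1) (fun i s => L (φ i s) (ψ i s)) := by
  induction hφ with
  | monomial k a ha => exact Jet.bilin hh L (.monomial k a ha) hψ
  | small φ hc hb =>
    exact .small _ (fun i => continuousOn_bilin L (hc i) (hψ.continuousOn i)) (hb.bilin hh L hψ1)
  | add φ χ _ _ h1 h2 => exact .congr _ _ (.add _ _ h1 h2) (by simp)
  | congr φ χ _ he h1 => exact .congr _ _ h1 fun i s hs => by rw [he i s hs]

theorem continuousOn_integral {φ : ℝ → E} (hφ : ContinuousOn φ (Icc 0 1)) :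
    ContinuousOn (fun s => ∫ σ in (0 : ℝ)..s, φ σ) (Icc 0 1) := by
  have := intervalIntegral.continuousOn_primitive_interval (μ := MeasureTheory.volume)
    (a := (0 : ℝ)) (b := 1) (f := φ) ?_
  · rwa [uIcc_of_le zero_le_one] at this
  · rw [uIcc_of_le zero_le_one]
    exact hφ.integrableOn_Icc

/-- In physical time `h ∫_0^s` is a plain integral: it raises the degree of each monomial by one and
gives the remainder a factor `h`. -/
theorem Jet.integral [CompleteSpace E] (hh : ∀ i, h i ∈ Ioc (0 : ℝ) 1) {φ : ι → ℝ → E}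
    (hφ : Jet h r φ) : Jet h (r + 1) (fun i s => h i • ∫ σ in (0 : ℝ)..s, φ i σ) := by
  induction hφ with
  | monomial k a ha =>
    refine .congr _ _ (.monomial (k + 1) (fun i => ((k : ℝ) + 1)⁻¹ • a i) ?_) ?_
    · obtain ⟨C, hC⟩ := ha
      refine ⟨((k : ℝ) + 1)⁻¹ * C, fun i => ?_⟩
      rw [norm_smul, Real.norm_of_nonneg (by positivity)]
      gcongr
      exact hC i
    · intro i s _
      simp only [mul_pow]
      rw [intervalIntegral.integral_smul_const, intervalIntegral.integral_const_mul, integral_pow,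
        smul_smul, smul_smul]
      congr 1
      simp
      ring
  | small φ hc hb =>
    exact .small _ (fun i => continuousOn_const.smul (continuousOn_integral (hc i)))
      ((hb.integral hh).smul_step hh)
  | add φ ψ hφ hψ h1 h2 =>
    refine .congr _ _ (.add _ _ h1 h2) fun i s hs => ?_
    simp only [Pi.add_apply]
    rw [intervalIntegral.integral_add (hφ.intervalIntegrable i (by simp) hs)
      (hψ.intervalIntegrable i (by simp) hs), smul_add]
  | congr φ ψ _ he h1 =>
    refine .congr _ _ h1 fun i s hs => ?_
    congr 1
    refine intervalIntegral.integral_congr fun σ hσ => he i σ ?_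
    rw [uIcc_of_le hs.1] at hσ
    exact ⟨hσ.1, hσ.2.trans hs.2⟩

end Jets

end SDC

namespace SDC

/-! ### Interpolation, quadrature and Taylor expansion of jets -/

section Interpolation

variable {ι E : Type*} [NormedAddCommGroup E] [NormedSpace ℝ E]
  {h : ι → ℝ} {r M : ℕ} {e : Fin M → ℝ}

/-- The polynomial with values `y j` at the nodes `e j`. -/
noncomputable def interp (e : Fin M → ℝ) (y : Fin M → E) (s : ℝ) : E :=
  ∑ j, (Lagrange.basis Finset.univ e j).eval s • y j

theorem continuous_interp (e : Fin M → ℝ) (y : Fin M → E) : Continuous (interp e y) :=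
  continuous_finsetSum _ fun _ _ => (Polynomial.continuous _).smul continuous_const

theorem interp_add (y z : Fin M → E) (s : ℝ) :
    interp e (y + z) s = interp e y s + interp e z s := by
  simp [interp, Finset.sum_add_distrib]

theorem interp_node (he : Function.Injective e) (y : Fin M → E) (j : Fin M) :
    interp e y (e j) = y j := by
  unfold interp
  rw [Finset.sum_eq_single j]
  · rw [Lagrange.eval_basis_self he.injOn (Finset.mem_univ j), one_smul]
  · intro k _ hk
    rw [Lagrange.eval_basis_of_ne hk (Finset.mem_univ j), zero_smul]
  · simp

theorem interp_monomial (he : Function.Injective e) {k : ℕ} (hk : k < M) (c : ℝ) (a : E) (s : ℝ) :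
    interp e (fun j => (c * e j) ^ k • a) s = (c * s) ^ k • a := by
  have h1 := Lagrange.eq_interpolate (s := Finset.univ) (v := e)
    (f := (Polynomial.X ^ k : Polynomial ℝ)) he.injOn (by simpa using hk)
  have h2 := congrArg (Polynomial.eval s) h1
  rw [Lagrange.interpolate_apply, Polynomial.eval_finsetSum] at h2
  simp only [Polynomial.eval_pow, Polynomial.eval_X, Polynomial.eval_mul, Polynomial.eval_C] at h2
  rw [mul_pow, h2, Finset.mul_sum, Finset.sum_smul]
  refine Finset.sum_congr rfl fun j _ => ?_
  rw [smul_smul]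
  ring_nf

theorem integral_interp [CompleteSpace E] (y : Fin M → E) (b : ℝ) :
    ∫ s in (0 : ℝ)..b, interp e y s = ∑ j, weight e b j • y j := by
  unfold interp
  rw [intervalIntegral.integral_finsetSum]
  · simp only [intervalIntegral.integral_smul_const]
    rfl
  · intro j _
    exact Continuous.intervalIntegrable ((Polynomial.continuous _).smul continuous_const) _ _

theorem exists_bound_basis (e : Fin M → ℝ) :
    ∃ K : ℝ, 0 ≤ K ∧ ∀ j, ∀ s ∈ Icc (0 : ℝ) 1, |(Lagrange.basis Finset.univ e j).eval s| ≤ K := by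
  have (j : Fin M) : ∃ K : ℝ, ∀ s ∈ Icc (0 : ℝ) 1,
      ‖(Lagrange.basis Finset.univ e j).eval s‖ ≤ K :=
    isCompact_Icc.exists_bound_of_continuousOn (Polynomial.continuous _).continuousOn
  choose K hK using this
  refine ⟨∑ j, |K j|, by positivity, fun j s hs => (hK j s hs).trans ((le_abs_self _).trans ?_)⟩
  exact Finset.single_le_sum (f := fun j => |K j|) (fun _ _ => abs_nonneg _) (Finset.mem_univ j)

theorem bigO_interp {y : ι → Fin M → E} (hh : ∀ i, h i ∈ Ioc (0 : ℝ) 1)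
    (hy : ∀ j, BigO h r fun i _ => y i j) : BigO h r fun i s => interp e (y i) s := by
  obtain ⟨K, hK0, hK⟩ := exists_bound_basis e
  refine BigO.sum _ fun j _ => ?_
  obtain ⟨C, hC0, hC⟩ := (hy j).exists_nonneg hh
  refine ⟨K * C, fun i s hs => ?_⟩
  have := (hh i).1
  rw [norm_smul, mul_assoc]
  gcongr
  · exact hK j s hs
  · exact hC i s hs

/-- The interpolant has degree less than `M` in `s`. Writing `s ^ k = (h s) ^ k * h ^ (-k)` costs `h
^ (-k)` with `k < M`, which node values of size `O(h ^ M)` absorb; no remainder is left, so the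
order `r` is arbitrary. -/
theorem jet_interp_of_bigO (he : Function.Injective e) {y : ι → Fin M → E}
    (hh : ∀ i, h i ∈ Ioc (0 : ℝ) 1) (hy : ∀ j, BigO h M fun i _ => y i j) :
    Jet h r fun i s => interp e (y i) s := by
  refine Jet.sum _ fun j _ => ?_
  obtain ⟨C, hC0, hC⟩ := (hy j).exists_nonneg hh
  have hdeg : (Lagrange.basis Finset.univ e j).natDegree < M := by
    rw [Lagrange.natDegree_basis he.injOn (Finset.mem_univ j)]
    have := j.pos
    simp
    omega
  refine .congr _ _ (Jet.sum (Finset.range M) (φ := fun k i s => (h i * s) ^ k •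
    (((Lagrange.basis Finset.univ e j).coeff k * (h i ^ k)⁻¹) • y i j)) fun k hk => ?_) ?_
  · refine .monomial k _ ⟨|(Lagrange.basis Finset.univ e j).coeff k| * C, fun i => ?_⟩
    have h0 := (hh i).1
    rw [norm_smul, norm_mul, norm_inv, Real.norm_of_nonneg (by positivity : 0 ≤ h i ^ k), mul_assoc,
      Real.norm_eq_abs]
    gcongr
    rw [inv_mul_le_iff₀ (by positivity), mul_comm]
    refine (hC i 0 (by simp)).trans ?_
    exact mul_le_mul_of_nonneg_left
      (pow_le_pow_of_le_one h0.le (hh i).2 (Finset.mem_range.1 hk).le) hC0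
  · intro i s _
    have h0 := (hh i).1.ne'
    rw [Polynomial.eval_eq_sum_range' hdeg, Finset.sum_smul]
    refine Finset.sum_congr rfl fun k _ => ?_
    rw [smul_smul]
    congr 1
    rw [mul_pow]
    field_simp

theorem Jet.interp (he : Function.Injective e) (he01 : ∀ j, e j ∈ Icc (0 : ℝ) 1)
    (hh : ∀ i, h i ∈ Ioc (0 : ℝ) 1) (hr : M ≤ r) {φ : ι → ℝ → E} (hφ : Jet h r φ) :
    Jet h r fun i s => interp e (fun j => φ i (e j)) s := by
  induction hφ with
  | monomial k a ha =>
    rcases lt_or_ge k M with hk | hk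
    · exact .congr _ _ (.monomial k a ha) fun i s _ => interp_monomial he hk _ _ _
    · exact jet_interp_of_bigO he hh fun j => ((bigO_monomial hh k ha).at (he01 j)).of_le hh hk
  | small φ hc hb => exact jet_interp_of_bigO he hh fun j => (hb.at (he01 j)).of_le hh hr
  | add φ ψ _ _ h1 h2 => exact .congr _ _ (.add _ _ h1 h2) fun i s _ => interp_add _ _ _
  | congr φ ψ _ hs h1 =>
    refine .congr _ _ h1 fun i s _ => ?_
    simp only [hs i _ (he01 _)]

/-- Monomials of degree less than `M` are reproduced exactly; the others, like the remainder, are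
already small, and so are their interpolants. -/
theorem Jet.interp_error (he : Function.Injective e) (he01 : ∀ j, e j ∈ Icc (0 : ℝ) 1)
    (hh : ∀ i, h i ∈ Ioc (0 : ℝ) 1) {φ : ι → ℝ → E} (hφ : Jet h r φ) :
    BigO h (min r M) fun i s => φ i s - SDC.interp e (fun j => φ i (e j)) s := by
  induction hφ with
  | monomial k a ha =>
    rcases lt_or_ge k M with hk | hk
    · exact ⟨0, fun i s _ => by simp [interp_monomial he hk]⟩
    · have h1 := (bigO_monomial hh k ha).of_le hh ((min_le_right r M).trans hk)
      exact h1.sub (bigO_interp hh fun j => h1.at (he01 j))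
  | small φ hc hb =>
    have h1 := hb.of_le hh (min_le_left r M)
    exact h1.sub (bigO_interp hh fun j => h1.at (he01 j))
  | add φ ψ _ _ h1 h2 =>
    refine (h1.add h2).congr fun i s _ => ?_
    have := interp_add (e := e) (fun j => φ i (e j)) (fun j => ψ i (e j)) s
    simp only [Pi.add_apply, Pi.add_def] at this ⊢
    rw [this]
    abel
  | congr φ ψ _ hs h1 =>
    refine h1.congr fun i s hs' => ?_
    simp only [hs i _ (he01 _), hs i s hs']

/-- The rule is exact on monomials of degree less than `r`. Everything else is `O(h ^ r)`, and both
the integral and the quadrature sum preserve this bound. -/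
theorem Jet.quadrature_error [CompleteSpace E] (he01 : ∀ j, e j ∈ Icc (0 : ℝ) 1)
    (hh : ∀ i, h i ∈ Ioc (0 : ℝ) 1) (hq : QuadratureOrder e r) {φ : ι → ℝ → E} (hφ : Jet h r φ) :
    BigO h r fun i _ => (∫ s in (0 : ℝ)..1, φ i s) - ∑ j, weight e 1 j • φ i (e j) := by
  have aux (φ : ι → ℝ → E) (hb : BigO h r φ) :
      BigO h r fun i _ => (∫ s in (0 : ℝ)..1, φ i s) - ∑ j, weight e 1 j • φ i (e j) := by
    refine ((hb.integral hh).at (t := 1) (by simp)).sub (BigO.sum _ fun j _ => ?_)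
    obtain ⟨C, hC⟩ := hb
    refine ⟨|weight e 1 j| * C, fun i _ _ => ?_⟩
    rw [norm_smul, Real.norm_eq_abs, mul_assoc]
    gcongr
    exact hC i _ (he01 j)
  induction hφ with
  | monomial k a ha =>
    rcases lt_or_ge k r with hk | hk
    · refine ⟨0, fun i _ _ => ?_⟩
      have h1 := hq (Polynomial.X ^ k) (by rw [Polynomial.degree_X_pow]; exact_mod_cast hk)
      simp only [Polynomial.eval_pow, Polynomial.eval_X] at h1
      have h2 : ∫ s in (0 : ℝ)..1, (h i * s) ^ k • a i =
          ∑ j, weight e 1 j • (h i * e j) ^ k • a i := by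
        simp only [mul_pow]
        rw [intervalIntegral.integral_smul_const, intervalIntegral.integral_const_mul, ← h1,
          Finset.mul_sum, Finset.sum_smul]
        refine Finset.sum_congr rfl fun j _ => ?_
        rw [smul_smul]
        ring_nf
      simp only [h2, sub_self, norm_zero, zero_mul, le_refl]
    · exact aux _ ((bigO_monomial hh k ha).of_le hh hk)
  | small φ hc hb => exact aux φ hb
  | add φ ψ hφ hψ h1 h2 =>
    refine (h1.add h2).congr fun i s _ => ?_
    simp only [Pi.add_apply]
    rw [intervalIntegral.integral_add (hφ.intervalIntegrable i (by simp) (by simp))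
      (hψ.intervalIntegrable i (by simp) (by simp))]
    simp only [smul_add, Finset.sum_add_distrib]
    abel
  | congr φ ψ _ hs h1 =>
    refine h1.congr fun i s _ => ?_
    simp only [hs i _ (he01 _)]
    congr 1
    refine intervalIntegral.integral_congr fun σ hσ => hs i σ ?_
    rwa [uIcc_of_le zero_le_one] at hσ

/-- A function which is differentiable on an interval, along a step of size `h`. -/
theorem integral_step [CompleteSpace E] {g g' : ℝ → E} {a b t h : ℝ}
    (hg : ∀ y ∈ Icc a b, HasDerivWithinAt g (g' y) (Icc a b) y)
    (hg' : ContinuousOn g' (Icc a b)) (h0 : 0 < h) (hat : a ≤ t) (htb : t + h ≤ b) {s : ℝ}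
    (hs : s ∈ Icc (0 : ℝ) 1) :
    h • ∫ σ in (0 : ℝ)..s, g' (t + h * σ) = g (t + h * s) - g t := by
  have hmem : ∀ σ ∈ Icc (0 : ℝ) s, t + h * σ ∈ Icc a b := by
    intro σ hσ
    have : h * σ ≤ h * 1 := by gcongr; exact hσ.2.trans hs.2
    exact ⟨by nlinarith [hσ.1], by linarith⟩
  have hcont : ContinuousOn (fun σ => t + h * σ) (Icc 0 s) := Continuous.continuousOn (by fun_prop)
  rw [← intervalIntegral.integral_smul]
  have := intervalIntegral.integral_eq_sub_of_hasDerivAt_of_le (f := fun σ => g (t + h * σ))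
    (f' := fun σ => h • g' (t + h * σ)) hs.1 ?_ ?_ ?_
  · simpa using this
  · exact ContinuousOn.comp (t := Icc a b) (fun y hy => (hg y hy).continuousWithinAt) hcont hmem
  · intro σ hσ
    have h1 : t + h * σ ∈ Ioo a b := by
      have : h * σ < h * 1 := by gcongr; exact hσ.2.trans_le hs.2
      have : 0 < h * σ := mul_pos h0 hσ.1
      exact ⟨by linarith, by linarith⟩
    have h2 := (hg _ (Ioo_subset_Icc_self h1)).hasDerivAt (Icc_mem_nhds h1.1 h1.2)
    have h3 : HasDerivAt (fun σ => t + h * σ) h σ := by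
      simpa using ((hasDerivAt_id σ).const_mul h).const_add t
    exact h2.scomp σ h3
  · refine ContinuousOn.intervalIntegrable ?_
    rw [uIcc_of_le hs.1]
    exact (hg'.comp hcont hmem).const_smul h

/-- Taylor's formula by iterating `g(t + h s) = g(t) + h ∫_0^s g'(t + h σ) dσ`. Compactness of `[a,
b]` makes the bounds independent of the base points `t i`. -/
theorem jet_of_contDiffOn [CompleteSpace E] {a b : ℝ} (hab : a < b) {t : ι → ℝ}
    (hh : ∀ i, h i ∈ Ioc (0 : ℝ) 1) (hat : ∀ i, a ≤ t i) (htb : ∀ i, t i + h i ≤ b) (r : ℕ)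
    {g : ℝ → E} (hg : ContDiffOn ℝ r g (Icc a b)) : Jet h r fun i s => g (t i + h i * s) := by
  have hmem : ∀ i, ∀ s ∈ Icc (0 : ℝ) 1, t i + h i * s ∈ Icc a b := by
    intro i s hs
    have h0 := (hh i).1
    have h1 : h i * s ≤ h i * 1 := by gcongr; exact hs.2
    have h2 : 0 ≤ h i * s := mul_nonneg h0.le hs.1
    exact ⟨by linarith [hat i], by linarith [htb i]⟩
  induction r generalizing g with
  | zero =>
    refine .small _ (fun i => hg.continuousOn.comp (Continuous.continuousOn (by fun_prop))
      (hmem i)) ?_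
    obtain ⟨C, hC⟩ := isCompact_Icc.exists_bound_of_continuousOn hg.continuousOn
    exact ⟨C, fun i s hs => by simpa using hC _ (hmem i s hs)⟩
  | succ r ih =>
    have hu : UniqueDiffOn ℝ (Icc a b) := uniqueDiffOn_Icc hab
    have hg' : ContDiffOn ℝ r (derivWithin g (Icc a b)) (Icc a b) :=
      hg.derivWithin hu (by norm_cast)
    obtain ⟨C, hC⟩ := isCompact_Icc.exists_bound_of_continuousOn hg.continuousOn
    refine .congr _ _ (.add _ _ (Jet.const (a := fun i => g (t i)) ⟨C, fun i => hC _ ?_⟩)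
      ((ih hg').integral hh)) fun i s hs => ?_
    · simpa using hmem i 0 (by simp)
    · simp only [Pi.add_apply]
      rw [integral_step (g := g) (fun y hy => ?_) hg'.continuousOn (hh i).1 (hat i) (htb i) hs]
      · abel
      · exact ((hg.differentiableOn (by simp)) y hy).hasDerivWithinAt

end Interpolation

end SDC

namespace SDC

/-! ### Variation of constants, stability at the nodes, and the quadratic remainder -/

section LocalError

variable {ι E : Type*} [NormedAddCommGroup E] [NormedSpace ℝ E]
  {h : ι → ℝ} {r M : ℕ} {e : Fin M → ℝ}

/-- Iterates of `B ↦ 1 + h ∫_s^1 B J` approximate the backward resolvent of `J`. -/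
theorem exists_approx_resolvent [CompleteSpace E] (hh : ∀ i, h i ∈ Ioc (0 : ℝ) 1)
    {J : ι → ℝ → E →L[ℝ] E} (hJ : Jet h r J) (n : ℕ) :
    ∃ B B₀ : ι → ℝ → E →L[ℝ] E, Jet h (r + 1) B ∧ Jet h (r + 1) B₀ ∧ BigO h n (B - B₀) ∧
      ∀ i, ∀ s ∈ Icc (0 : ℝ) 1, B i s = 1 + h i • ((∫ σ in (0 : ℝ)..1, B₀ i σ * J i σ) -
        ∫ σ in (0 : ℝ)..s, B₀ i σ * J i σ) := by
  have jet_one : Jet h (r + 1) fun (_ : ι) (_ : ℝ) => (1 : E →L[ℝ] E) :=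
    Jet.const ⟨‖(1 : E →L[ℝ] E)‖, fun _ => le_rfl⟩
  induction n with
  | zero =>
    refine ⟨fun _ _ => 1, fun _ _ => 0, jet_one, Jet.const ⟨0, by simp⟩, ?_, by simp⟩
    exact ⟨‖(1 : E →L[ℝ] E)‖, by simp⟩
  | succ n ih =>
    obtain ⟨B, B₀, hB, hB₀, hd, hs⟩ := ih
    have mulJ {A : ι → ℝ → E →L[ℝ] E} (hA : Jet h (r + 1) A) :
        Jet h r fun i s => A i s * J i s :=
      Jet.bilin hh (ContinuousLinearMap.mul ℝ (E →L[ℝ] E)) (hA.of_le hh (Nat.le_succ r)) hJ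
    have hBJ := mulJ hB
    have hB₀J := mulJ hB₀
    have hprim := hBJ.integral hh
    have hBJ_one : Jet h (r + 1) fun i (_ : ℝ) => h i • ∫ σ in (0 : ℝ)..1, B i σ * J i σ := by
      obtain ⟨C, hC⟩ := hprim.bigO hh
      exact Jet.const ⟨C, fun i => by simpa using hC i 1 (by simp)⟩
    -- One more Picard iterate. Finitely many suffice, which keeps `B` within jets; the integration
    -- lifts the order `r` of `B * J` to `r + 1`.
    refine ⟨fun i s => 1 + h i • ((∫ σ in (0 : ℝ)..1, B i σ * J i σ) -
      ∫ σ in (0 : ℝ)..s, B i σ * J i σ), B, ?_, hB, ?_, fun _ _ _ => rfl⟩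
    · refine .congr _ _ (.add _ _ jet_one (hBJ_one.sub hprim)) fun i s _ => ?_
      simp [smul_sub]
    · have hdJ : BigO h n fun i s => (B - B₀) i s * J i s :=
        hd.bilin hh (ContinuousLinearMap.mul ℝ (E →L[ℝ] E)) (hJ.bigO hh)
      have h1 := (hdJ.integral hh).smul_step hh
      refine ((h1.at (t := 1) (by simp)).sub h1).congr fun i s hs' => ?_
      have key : ∀ t ∈ Icc (0 : ℝ) 1, (∫ σ in (0 : ℝ)..t, (B - B₀) i σ * J i σ) =
          (∫ σ in (0 : ℝ)..t, B i σ * J i σ) - ∫ σ in (0 : ℝ)..t, B₀ i σ * J i σ := by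
        intro t ht
        rw [← intervalIntegral.integral_sub (hBJ.intervalIntegrable i (by simp) ht)
          (hB₀J.intervalIntegrable i (by simp) ht)]
        simp [sub_mul]
      simp only [Pi.sub_apply] at key ⊢
      rw [hs i s hs', key s hs', key 1 (by simp)]
      module

theorem hasDerivAt_integral_of_continuousOn [CompleteSpace E] {φ : ℝ → E}
    (hφ : ContinuousOn φ (Icc 0 1)) {s : ℝ} (hs : s ∈ Ioo (0 : ℝ) 1) :
    HasDerivAt (fun t => ∫ σ in (0 : ℝ)..t, φ σ) (φ s) s := by
  have hn : Icc (0 : ℝ) 1 ∈ nhds s := Icc_mem_nhds hs.1 hs.2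
  refine intervalIntegral.integral_hasDerivAt_right ?_ ?_ (hφ.continuousAt hn)
  · refine (hφ.mono ?_).intervalIntegrable
    exact uIcc_subset_Icc (by simp) (Ioo_subset_Icc_self hs)
  · exact hφ.stronglyMeasurableAtFilter_nhdsWithin measurableSet_Icc s |>.filter_mono
      (by rw [nhdsWithin_eq_nhds.2 hn])

/-- If the defect of a linearized error equation is small at the nodes, then the error at the end
of the step is of the order of the quadrature rule. -/
theorem bigO_of_small_defect [CompleteSpace E] (he01 : ∀ j, e j ∈ Icc (0 : ℝ) 1)
    (hh : ∀ i, h i ∈ Ioc (0 : ℝ) 1) (hq : QuadratureOrder e (r + 1))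
    {J : ι → ℝ → E →L[ℝ] E} (hJ : Jet h r J) {w : ι → ℝ → E} (hw : Jet h (r + 1) w)
    {η : ι → ℝ → E} (hη : ∀ i s, η i s = h i • ∫ σ in (0 : ℝ)..s, w i σ)
    (hδ : ∀ j, BigO h (r + 1) fun i _ => w i (e j) - J i (e j) (η i (e j))) :
    BigO h (r + 2) fun i _ => η i 1 := by
  -- With `r + 1` iterates the error from using an approximate resolvent matches the quadrature
  -- error.
  obtain ⟨B, B₀, hB, hB₀, hd, hs⟩ := exists_approx_resolvent hh hJ (r + 1)
  have hηe : η = fun i s => h i • ∫ σ in (0 : ℝ)..s, w i σ := by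
    funext i s
    exact hη i s
  have hηJ : Jet h (r + 1) η := by
    rw [hηe]
    exact (hw.integral hh).of_le hh (Nat.le_succ _)
  have hη1 : BigO h 1 η := by
    rw [hηe]
    exact ((hw.bigO hh).integral hh).smul_step hh
  let ev : (E →L[ℝ] E) →L[ℝ] E →L[ℝ] E := ContinuousLinearMap.id ℝ _
  have hJη : Jet h (r + 1) fun i s => J i s (η i s) := Jet.bilin_of_bigO_one hh ev hJ hηJ hη1
  have hBδ : Jet h (r + 1) fun i s => B i s (w i s - J i s (η i s)) :=
    Jet.bilin hh ev hB (hw.sub hJη)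
  have hdJη : BigO h (r + 1) fun i s => (B i s - B₀ i s) (J i s (η i s)) :=
    hd.bilin hh ev (hJη.bigO hh)
  -- The integral is the quadrature error plus the quadrature sum, and the sum only involves the
  -- defect at the nodes.
  have hquad : BigO h (r + 1) fun i _ => ∫ s in (0 : ℝ)..1, B i s (w i s - J i s (η i s)) := by
    refine ((hBδ.quadrature_error he01 hh hq).add (BigO.sum Finset.univ
      (φ := fun j i _ => weight e 1 j • B i (e j) (w i (e j) - J i (e j) (η i (e j))))
      fun j _ => ?_)).congr fun i s _ => ?_
    · have h1 := ((hB.bigO hh).at (he01 j)).bilin hh (weight e 1 j • ev) (hδ j)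
      rwa [zero_add] at h1
    · simp
  -- Integrate `(B η)' = h (B w - B₀ J η)` over `[0, 1]`, using `B 1 = 1` and `η 0 = 0`, and split
  -- the integrand as `B (w - J η) + (B - B₀) J η`.
  have hrep : ∀ i, η i 1 = h i • ((∫ s in (0 : ℝ)..1, B i s (w i s - J i s (η i s))) +
      ∫ s in (0 : ℝ)..1, (B i s - B₀ i s) (J i s (η i s))) := by
    intro i
    have hB₀J : ContinuousOn (fun s => B₀ i s * J i s) (Icc 0 1) :=
      (hB₀.continuousOn i).mul (hJ.continuousOn i)
    have hB₀Jη : ContinuousOn (fun s => B₀ i s (J i s (η i s))) (Icc 0 1) :=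
      (hB₀.continuousOn i).clm_apply (hJη.continuousOn i)
    have hBw : ContinuousOn (fun s => B i s (w i s)) (Icc 0 1) :=
      (hB.continuousOn i).clm_apply (hw.continuousOn i)
    have hBJη : ContinuousOn (fun s => B i s (J i s (η i s))) (Icc 0 1) :=
      (hB.continuousOn i).clm_apply (hJη.continuousOn i)
    have ii {φ : ℝ → E} (hφ : ContinuousOn φ (Icc 0 1)) :
        IntervalIntegrable φ MeasureTheory.volume 0 1 := by
      refine ContinuousOn.intervalIntegrable ?_
      rwa [uIcc_of_le zero_le_one]
    have key := intervalIntegral.integral_eq_sub_of_hasDerivAt_of_le (a := 0) (b := 1)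
      (f := fun s => B i s (η i s))
      (f' := fun s => h i • (B i s (w i s) - B₀ i s (J i s (η i s)))) zero_le_one
      ((hB.continuousOn i).clm_apply (hηJ.continuousOn i)) ?_
      (ii ((hBw.sub hB₀Jη).const_smul (h i)))
    · have hB1 : B i 1 = 1 := by rw [hs i 1 (by simp)]; simp
      have hη0 : η i 0 = 0 := by rw [hη]; simp
      rw [hB1, hη0, map_zero, sub_zero, one_apply_eq_self,
        intervalIntegral.integral_smul] at key
      rw [← key]
      congr 1
      rw [← intervalIntegral.integral_add (ii (hBδ.continuousOn i)) (ii ?_)]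
      · refine intervalIntegral.integral_congr fun s _ => ?_
        simp
      · exact hBJη.sub hB₀Jη
    · intro s hs'
      have d1 : HasDerivAt (B i) (-(h i • (B₀ i s * J i s))) s := by
        have h1 := (((hasDerivAt_integral_of_continuousOn hB₀J hs').const_sub
          (∫ σ in (0 : ℝ)..1, B₀ i σ * J i σ)).const_smul (h i)).const_add (1 : E →L[ℝ] E)
        rw [smul_neg] at h1
        refine h1.congr_of_eventuallyEq ?_
        filter_upwards [Icc_mem_nhds hs'.1 hs'.2] with t ht
        exact hs i t ht
      have d2 : HasDerivAt (η i) (h i • w i s) s := by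
        rw [hηe]
        exact (hasDerivAt_integral_of_continuousOn (hw.continuousOn i) hs').const_smul (h i)
      refine (d1.clm_apply d2).congr_deriv ?_
      simp only [neg_apply, smul_apply, mul_apply_eq_comp, map_smul]
      module
  exact ((hquad.add ((hdJη.integral hh).at (t := 1) (by simp))).smul_step hh).congr
    fun i s _ => hrep i

/-- A bound for the errors at the nodes from a stability argument. -/
theorem bigO_node_error (hh : ∀ i, h i ∈ Ioc (0 : ℝ) 1) {D ψ : ι → Fin M → E} {ρ : ι → ℝ → E}
    {K : ℝ} (hK : 0 ≤ K) (he01 : ∀ j, e j ∈ Icc (0 : ℝ) 1)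
    (hD : ∀ i j, D i j = h i • (∑ k, weight e (e j) k • ψ i k - ρ i (e j)))
    (hψ : ∀ i j, ‖ψ i j‖ ≤ K * ‖D i j‖) (hρ : BigO h r ρ)
    (hsmall : ∀ i, h i * ((∑ j, ∑ k, |weight e (e j) k|) * K) ≤ 1 / 2) (j : Fin M) :
    BigO h (r + 1) fun i _ => D i j := by
  obtain ⟨C, hC0, hC⟩ := hρ.exists_nonneg hh
  refine ⟨2 * C, fun i _ _ => ?_⟩
  have h0 := (hh i).1
  have hbound : ‖D i‖ ≤ h i * ((∑ j, ∑ k, |weight e (e j) k|) * K) * ‖D i‖ + C * h i ^ (r + 1) := by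
    rw [pi_norm_le_iff_of_nonneg (by positivity)]
    intro j
    rw [hD i j, norm_smul, Real.norm_of_nonneg h0.le]
    have h1 : ‖∑ k, weight e (e j) k • ψ i k‖ ≤ (∑ j, ∑ k, |weight e (e j) k|) * K * ‖D i‖ := by
      calc ‖∑ k, weight e (e j) k • ψ i k‖ ≤ ∑ k, |weight e (e j) k| * (K * ‖D i‖) := by
            refine norm_sum_le_of_le _ fun k _ => ?_
            rw [norm_smul, Real.norm_eq_abs]
            gcongr
            exact (hψ i k).trans (by gcongr; exact norm_le_pi_norm (D i) k)
        _ = (∑ k, |weight e (e j) k|) * (K * ‖D i‖) := by rw [Finset.sum_mul]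
        _ ≤ (∑ j, ∑ k, |weight e (e j) k|) * (K * ‖D i‖) := by
            refine mul_le_mul_of_nonneg_right ?_ (by positivity)
            exact Finset.single_le_sum (f := fun j => ∑ k, |weight e (e j) k|)
              (fun _ _ => by positivity) (Finset.mem_univ j)
        _ = _ := by ring
    calc h i * ‖∑ k, weight e (e j) k • ψ i k - ρ i (e j)‖
        ≤ h i * ((∑ j, ∑ k, |weight e (e j) k|) * K * ‖D i‖ + C * h i ^ r) := by
          gcongr
          exact (norm_sub_le _ _).trans (add_le_add h1 (hC i _ (he01 j)))
      _ = _ := by ring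
  -- The part proportional to `‖D i‖` is absorbed into the left-hand side, which produces the factor
  -- `2`.
  have h2 : h i * ((∑ j, ∑ k, |weight e (e j) k|) * K) * ‖D i‖ ≤ 1 / 2 * ‖D i‖ := by
    gcongr
    exact hsmall i
  calc ‖D i j‖ ≤ ‖D i‖ := norm_le_pi_norm (D i) j
    _ ≤ 2 * C * h i ^ (r + 1) := by linarith

/-- Near `K` this is Taylor's formula on balls inside a compact thickening. At distance more than
`δ` the linear Lipschitz bound is already quadratic up to the factor `1 / δ`, so `y` needs no
restriction. -/
theorem exists_quadratic_remainder [ProperSpace E] {G : E → E} {U K : Set E}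
    (hU : IsOpen U) (hK : IsCompact K) (hKU : K ⊆ U) (hG : ContDiffOn ℝ 2 G U) {L : NNReal}
    (hL : LipschitzWith L G) :
    ∃ C : ℝ, 0 ≤ C ∧ ∀ z ∈ K, ∀ y,
      ‖G y - G z - fderiv ℝ G z (y - z)‖ ≤ C * ‖y - z‖ ^ 2 := by
  obtain ⟨δ, hδ, hsub⟩ := hK.exists_cthickening_subset_open hU hKU
  have hG1 : ContDiffOn ℝ 1 (fderiv ℝ G) U := hG.fderiv_of_isOpen hU (by norm_num)
  have hG2 : ContinuousOn (fderiv ℝ (fderiv ℝ G)) U :=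
    hG1.continuousOn_fderiv_of_isOpen hU (by norm_num)
  obtain ⟨C, hC⟩ := (hK.cthickening (r := δ)).exists_bound_of_continuousOn (hG2.mono hsub)
  refine ⟨max |C| (2 * L / δ), by positivity, fun z hz y => ?_⟩
  rcases lt_or_ge δ ‖y - z‖ with hy | hy
  · have h1 : ‖G y - G z‖ ≤ L * ‖y - z‖ := hL.norm_sub_le y z
    have h2 : ‖fderiv ℝ G z (y - z)‖ ≤ L * ‖y - z‖ :=
      (fderiv ℝ G z).le_of_opNorm_le (norm_fderiv_le_of_lipschitz ℝ hL) _
    calc ‖G y - G z - fderiv ℝ G z (y - z)‖ ≤ 2 * L * ‖y - z‖ := by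
          refine (norm_sub_le _ _).trans ?_
          linarith
      _ = 2 * L / δ * (‖y - z‖ * δ) := by field_simp
      _ ≤ 2 * L / δ * (‖y - z‖ * ‖y - z‖) := by gcongr
      _ ≤ max |C| (2 * L / δ) * ‖y - z‖ ^ 2 := by
          rw [← sq]
          gcongr
          exact le_max_right _ _
  have hball : ∀ w ∈ Metric.closedBall z ‖y - z‖, w ∈ Metric.cthickening δ K := fun w hw =>
    Metric.mem_cthickening_of_dist_le w z δ K hz ((Metric.mem_closedBall.1 hw).trans hy)
  have hz0 : z ∈ Metric.closedBall z ‖y - z‖ := Metric.mem_closedBall_self (norm_nonneg _)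
  have hconv : Convex ℝ (Metric.closedBall z ‖y - z‖) := convex_closedBall _ _
  have hd1 : ∀ w ∈ Metric.closedBall z ‖y - z‖, ‖fderiv ℝ G w - fderiv ℝ G z‖ ≤ |C| * ‖y - z‖ := by
    intro w hw
    have := hconv.norm_image_sub_le_of_norm_fderiv_le (𝕜 := ℝ) (f := fderiv ℝ G) (C := |C|)
      (fun a ha => (hG1.differentiableOn (by norm_num) a (hsub (hball a ha))).differentiableAt
        (hU.mem_nhds (hsub (hball a ha)))) (fun a ha => (hC a (hball a ha)).trans (le_abs_self C))
      hz0 hw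
    refine this.trans ?_
    gcongr
    exact mem_closedBall_iff_norm.1 hw
  have := hconv.norm_image_sub_le_of_norm_fderiv_le' (𝕜 := ℝ) (f := G) (φ := fderiv ℝ G z)
    (fun a ha => (hG.differentiableOn (by norm_num) a (hsub (hball a ha))).differentiableAt
        (hU.mem_nhds (hsub (hball a ha)))) hd1 hz0
    (mem_closedBall_iff_norm.2 (le_refl ‖y - z‖))
  refine this.trans ?_
  rw [mul_assoc, ← sq]
  gcongr
  exact le_max_left _ _

/-- The square of the nodal polynomial has degree `2 M` and positive integral, but the rule gives it
the value zero. -/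
theorem QuadratureOrder.le_two_mul {p : ℕ} (hq : QuadratureOrder e p) :
    p ≤ 2 * M := by
  by_contra! hlt
  set ω := Lagrange.nodal Finset.univ e with hω
  have h1 := hq (ω ^ 2) (by
    rw [Polynomial.degree_pow, Lagrange.degree_nodal]
    simpa using by exact_mod_cast hlt)
  have h2 : ∑ j, weight e 1 j * (ω ^ 2).eval (e j) = 0 := by
    refine Finset.sum_eq_zero fun j _ => ?_
    rw [Polynomial.eval_pow, hω, Lagrange.eval_nodal_at_node (Finset.mem_univ j)]
    simp
  rw [h2] at h1
  have hne : ω ≠ 0 := Lagrange.nodal_ne_zero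
  have hinf : (Icc (0 : ℝ) 1).Infinite := Icc_infinite zero_lt_one
  obtain ⟨c, hc, hc0⟩ : ∃ c ∈ Icc (0 : ℝ) 1, ω.eval c ≠ 0 := by
    by_contra! hall
    exact hne (Polynomial.eq_zero_of_infinite_isRoot ω (hinf.mono hall))
  have := intervalIntegral.integral_pos (f := fun s => (ω ^ 2).eval s) zero_lt_one
    (Polynomial.continuous _).continuousOn
    (fun s _ => by rw [Polynomial.eval_pow]; positivity)
    ⟨c, hc, by rw [Polynomial.eval_pow]; positivity⟩
  exact this.ne h1

end LocalError

end SDC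

namespace SDC

/-! ### Superconvergence of collocation for first-order systems -/

section Collocation

variable {ι E : Type*} [NormedAddCommGroup E] [NormedSpace ℝ E]
  {h : ι → ℝ} {M : ℕ} {e : Fin M → ℝ}

theorem contDiffOn_succ_of_hasDerivWithinAt {u u' : ℝ → E} {a b : ℝ} (hab : a < b) {p : ℕ}
    (hu : ∀ s ∈ Icc a b, HasDerivWithinAt u (u' s) (Icc a b) s)
    (hu' : ContDiffOn ℝ p u' (Icc a b)) : ContDiffOn ℝ (p + 1) u (Icc a b) := by
  have hd : UniqueDiffOn ℝ (Icc a b) := uniqueDiffOn_Icc hab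
  rw [contDiffOn_succ_iff_derivWithin hd]
  refine ⟨fun s hs => (hu s hs).differentiableWithinAt, by simp, ?_⟩
  exact hu'.congr fun s hs => (hu s hs).derivWithin (hd s hs)

/-- Collocation steps which start on the solution curve have a local error of the order of the
quadrature rule plus one. -/
theorem bigO_collocation_error [ProperSpace E] (he : StrictMono e)
    (he01 : ∀ j, e j ∈ Icc (0 : ℝ) 1) {p : ℕ} (hquad : QuadratureOrder e p)
    {G : E → E} {K : NNReal} (hG : LipschitzWith K G) {t₀ T : ℝ} (hT : t₀ < T) {u : ℝ → E}
    (hu : ∀ s ∈ Icc t₀ T, HasDerivWithinAt u (G (u s)) (Icc t₀ T) s)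
    (hreg : ContDiffOn ℝ p (fun s => G (u s)) (Icc t₀ T))
    (hsmooth : M + 1 < p → ∃ U : Set E, IsOpen U ∧ (∀ s ∈ Icc t₀ T, u s ∈ U) ∧ ContDiffOn ℝ p G U)
    (hh : ∀ i, h i ∈ Ioc (0 : ℝ) 1)
    (hsmall : ∀ i, h i * ((∑ j, ∑ k, |weight e (e j) k|) * K) ≤ 1 / 2)
    {t : ι → ℝ} (hat : ∀ i, t₀ ≤ t i) (htb : ∀ i, t i + h i ≤ T) {Y : ι → Fin M → E}
    (hY : ∀ i j, Y i j = u (t i) + h i • ∑ k, weight e (e j) k • G (Y i k)) :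
    BigO h (p + 1) fun i _ => u (t i) + h i • ∑ k, weight e 1 k • G (Y i k) - u (t i + h i) := by
  have hmem : ∀ i, ∀ s ∈ Icc (0 : ℝ) 1, t i + h i * s ∈ Icc t₀ T := by
    intro i s hs
    have h0 := (hh i).1
    have h1 : h i * s ≤ h i * 1 := by gcongr; exact hs.2
    have h2 : 0 ≤ h i * s := mul_nonneg h0.le hs.1
    exact ⟨by linarith [hat i], by linarith [htb i]⟩
  set g : ι → ℝ → E := fun i s => G (u (t i + h i * s)) with hgdef
  have hg : Jet h p g := jet_of_contDiffOn hT hh hat htb p hreg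
  set ε : ι → ℝ → E := fun i s => g i s - interp e (fun j => g i (e j)) s with hεdef
  have hε : BigO h (min p M) ε := hg.interp_error he.injective he01 hh
  set ψ : ι → Fin M → E := fun i k => G (Y i k) - g i (e k) with hψdef
  -- `η` is the collocation polynomial minus the solution, as `hηY` confirms. This form exhibits `η'
  -- / h` as the interpolated force error minus the interpolation error of the exact force.
  set η : ι → ℝ → E := fun i s => h i • ∫ σ in (0 : ℝ)..s, (interp e (ψ i) σ - ε i σ) with hηdef
  have hεc : ∀ i, ContinuousOn (ε i) (Icc 0 1) := fun i =>
    (hg.continuousOn i).sub (continuous_interp _ _).continuousOn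
  have ii {φ : ℝ → E} (hφ : ContinuousOn φ (Icc 0 1)) {b : ℝ} (hb : b ∈ Icc (0 : ℝ) 1) :
      IntervalIntegrable φ MeasureTheory.volume 0 b :=
    (hφ.mono (uIcc_subset_Icc (by simp) hb)).intervalIntegrable
  have hηψ : ∀ i, ∀ b ∈ Icc (0 : ℝ) 1,
      η i b = h i • (∑ k, weight e b k • ψ i k - ∫ σ in (0 : ℝ)..b, ε i σ) := by
    intro i b hb
    simp only [hηdef]
    rw [intervalIntegral.integral_sub (ii (continuous_interp _ _).continuousOn hb)
      (ii (hεc i) hb), integral_interp]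
  have hηY : ∀ i, ∀ b ∈ Icc (0 : ℝ) 1, η i b =
      u (t i) + h i • ∑ k, weight e b k • G (Y i k) - u (t i + h i * b) := by
    intro i b hb
    have hgi := integral_step hu hreg.continuousOn (hh i).1 (hat i) (htb i) hb
    rw [hηψ i b hb]
    simp only [hεdef]
    rw [intervalIntegral.integral_sub (ii (hg.continuousOn i) hb)
      (ii (continuous_interp _ _).continuousOn hb), integral_interp]
    simp only [hψdef, smul_sub, Finset.sum_sub_distrib]
    rw [hgi]
    abel
  have hηnode : ∀ i j, η i (e j) = Y i j - u (t i + h i * e j) := by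
    intro i j
    rw [hηY i _ (he01 j), ← hY]
  have hψη : ∀ i j, ‖ψ i j‖ ≤ K * ‖η i (e j)‖ := by
    intro i j
    rw [hηnode]
    exact hG.norm_sub_le _ _
  have hD : ∀ j, BigO h (min p M + 1) fun i _ => η i (e j) :=
    bigO_node_error (D := fun i j => η i (e j)) hh K.2 he01 (fun i j => hηψ i _ (he01 j)) hψη
      (hε.integral hh) hsmall
  have hψO : ∀ j, BigO h (min p M + 1) fun i _ => ψ i j := by
    intro j
    obtain ⟨C, hC⟩ := hD j
    refine ⟨K * C, fun i s hs => (hψη i j).trans ?_⟩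
    rw [mul_assoc]
    gcongr
    exact hC i s hs
  have hfin : BigO h (p + 1) fun i _ => η i 1 := by
    -- The node errors are `O(h ^ (min p M + 1))`. This already reaches `h ^ p` when `p ≤ M + 1`;
    -- beyond that the linearized equation is needed.
    rcases lt_or_ge (M + 1) p with hp | hp
    · obtain ⟨U, hU, huU, hGU⟩ := hsmooth hp
      obtain ⟨r, rfl⟩ : ∃ r, p = r + 1 := ⟨p - 1, by omega⟩
      have hmin : min (r + 1) M = M := by omega
      rw [hmin] at hψO hD
      have hw : Jet h (r + 1) fun i s => interp e (ψ i) s - ε i s :=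
        (jet_interp_of_bigO he.injective hh fun j => (hψO j).of_le hh (Nat.le_succ M)).sub
          (hg.sub (hg.interp he.injective he01 hh (by omega)))
      have huC : ContDiffOn ℝ r u (Icc t₀ T) :=
        (contDiffOn_succ_of_hasDerivWithinAt hT hu hreg).of_le (by norm_cast; omega)
      have hGC : ContDiffOn ℝ r (fderiv ℝ G) U := hGU.fderiv_of_isOpen hU (by norm_cast)
      have hJ : Jet h r fun i s => fderiv ℝ G (u (t i + h i * s)) :=
        jet_of_contDiffOn hT hh hat htb r (g := fun s => fderiv ℝ G (u s)) (hGC.comp huC huU)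
      refine bigO_of_small_defect he01 hh hquad hJ hw (η := η) (fun _ _ => rfl) fun j => ?_
      obtain ⟨C, hC0, hC⟩ := exists_quadratic_remainder hU
        (isCompact_Icc.image_of_continuousOn huC.continuousOn) (image_subset_iff.2 huU)
        (hGU.of_le (by norm_cast; omega)) hG
      obtain ⟨C', hC0', hC'⟩ := (hD j).exists_nonneg hh
      have h2M := hquad.le_two_mul
      -- Node errors `O(h ^ (M + 1))` are squared by the Taylor remainder, and `p ≤ 2 M` leaves room
      -- to spare.
      refine BigO.of_le hh (r := (M + 1) * 2) ⟨C * C' ^ 2, fun i s hs => ?_⟩ (by omega)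
      have hval : interp e (ψ i) (e j) - ε i (e j) = ψ i j := by
        simp [hεdef, interp_node he.injective]
      rw [hval, hηnode]
      refine (hC _ (mem_image_of_mem u (hmem i _ (he01 j))) _).trans ?_
      rw [← hηnode, mul_assoc, pow_mul, ← mul_pow]
      gcongr
      exact hC' i s hs
    · have hεint : BigO h p fun i _ => ∫ σ in (0 : ℝ)..1, ε i σ := by
        refine (hg.quadrature_error he01 hh hquad).congr fun i _ _ => ?_
        simp only [hεdef]
        rw [intervalIntegral.integral_sub (ii (hg.continuousOn i) (by simp))
          (ii (continuous_interp _ _).continuousOn (by simp)), integral_interp]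
      have hsum : BigO h p fun i _ => ∑ k, weight e 1 k • ψ i k := by
        refine BigO.sum _ fun k _ => ?_
        obtain ⟨C, hC⟩ := (hψO k).of_le (r' := p) hh (by omega)
        refine ⟨|weight e 1 k| * C, fun i s hs => ?_⟩
        rw [norm_smul, Real.norm_eq_abs, mul_assoc]
        gcongr
        exact hC i s hs
      exact ((hsum.sub hεint).smul_step hh).congr fun i _ _ => hηψ i 1 (by simp)
  refine hfin.congr fun i _ _ => ?_
  rw [hηY i 1 (by simp), mul_one]

/-- The local error of collocation for `u' = G(u)`. -/
theorem collocation_local_error [ProperSpace E] (he : StrictMono e)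
    (he01 : ∀ j, e j ∈ Icc (0 : ℝ) 1) {p : ℕ} (hquad : QuadratureOrder e p)
    {G : E → E} {K : NNReal} (hG : LipschitzWith K G) {t₀ T : ℝ} (hT : t₀ < T) {u : ℝ → E}
    (hu : ∀ s ∈ Icc t₀ T, HasDerivWithinAt u (G (u s)) (Icc t₀ T) s)
    (hreg : ContDiffOn ℝ p (fun s => G (u s)) (Icc t₀ T))
    (hsmooth : M + 1 < p → ∃ U : Set E, IsOpen U ∧ (∀ s ∈ Icc t₀ T, u s ∈ U) ∧
      ContDiffOn ℝ p G U) :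
    ∃ C h₀ : ℝ, 0 < h₀ ∧ ∀ h, 0 < h → h ≤ h₀ → ∀ t, t₀ ≤ t → t + h ≤ T → ∀ Y : Fin M → E,
      (∀ j, Y j = u t + h • ∑ k, weight e (e j) k • G (Y k)) →
      ‖u t + h • ∑ k, weight e 1 k • G (Y k) - u (t + h)‖ ≤ C * h ^ (p + 1) := by
  set W : ℝ := (∑ j, ∑ k, |weight e (e j) k|) * K with hW
  have hW0 : 0 ≤ W := by positivity
  set h₀ : ℝ := min 1 (1 / (2 * (W + 1))) with hh₀
  have hsmall : ∀ h : ℝ, 0 < h → h ≤ h₀ → h * W ≤ 1 / 2 := by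
    intro h h0 hh
    have h1 : h ≤ 1 / (2 * (W + 1)) := hh.trans (min_le_right _ _)
    rw [le_div_iff₀ (by positivity)] at h1
    nlinarith
  -- Indexing the family by all admissible triples `(h, t, Y)` turns the bound for families into one
  -- constant for all steps.
  obtain ⟨C, hC⟩ := bigO_collocation_error
    (ι := {a : ℝ × ℝ × (Fin M → E) // (0 < a.1 ∧ a.1 ≤ h₀) ∧ t₀ ≤ a.2.1 ∧ a.2.1 + a.1 ≤ T ∧
      ∀ j, a.2.2 j = u a.2.1 + a.1 • ∑ k, weight e (e j) k • G (a.2.2 k)})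
    (h := fun i => i.1.1) (t := fun i => i.1.2.1) (Y := fun i => i.1.2.2) he he01 hquad hG hT hu
    hreg hsmooth (fun i => ⟨i.2.1.1, i.2.1.2.trans (min_le_left _ _)⟩)
    (fun i => hsmall _ i.2.1.1 i.2.1.2) (fun i => i.2.2.1) (fun i => i.2.2.2.1)
    (fun i => i.2.2.2.2)
  exact ⟨C, h₀, by positivity, fun h h0 hh t ht ht' Y hY =>
    hC ⟨(h, t, Y), ⟨h0, hh⟩, ht, ht', hY⟩ 0 (by simp)⟩

end Collocation

end SDC

namespace SDC

/-! ### Implicit node equations: stability, uniqueness, existence -/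

section Discrete

variable {M n d : ℕ} {e : Fin M → ℝ} {f : Vec d × Vec d → Vec d} {L : NNReal} {h : ℝ}

/-- The sum of the absolute values of the entries of a matrix. -/
def entrySum (A : Matrix (Fin n) (Fin n) ℝ) : ℝ := ∑ m, ∑ l, |A m l|

theorem entrySum_nonneg (A : Matrix (Fin n) (Fin n) ℝ) : 0 ≤ entrySum A :=
  Finset.sum_nonneg fun _ _ => Finset.sum_nonneg fun _ _ => abs_nonneg _

theorem norm_sum_smul_le (c : Fin n → ℝ) (W : Fin n → Vec d) :
    ‖∑ l, c l • W l‖ ≤ (∑ l, |c l|) * ‖W‖ := by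
  rw [Finset.sum_mul]
  refine norm_sum_le_of_le _ fun l _ => ?_
  rw [norm_smul, Real.norm_eq_abs]
  gcongr
  exact norm_le_pi_norm W l

theorem norm_act_le (A : Matrix (Fin n) (Fin n) ℝ) (W : Fin n → Vec d) :
    ‖act A W‖ ≤ entrySum A * ‖W‖ := by
  rw [pi_norm_le_iff_of_nonneg (mul_nonneg (entrySum_nonneg A) (norm_nonneg W))]
  intro m
  refine (norm_sum_smul_le (A m) W).trans ?_
  refine mul_le_mul_of_nonneg_right ?_ (norm_nonneg W)
  exact Finset.single_le_sum (f := fun m => ∑ l, |A m l|)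
    (fun _ _ => Finset.sum_nonneg fun _ _ => abs_nonneg _) (Finset.mem_univ m)

theorem act_add (A : Matrix (Fin n) (Fin n) ℝ) (W Z : Fin n → Vec d) :
    act A (W + Z) = act A W + act A Z := by
  funext m
  simp [act, Finset.sum_add_distrib]

theorem act_sub (A : Matrix (Fin n) (Fin n) ℝ) (W Z : Fin n → Vec d) :
    act A (W - Z) = act A W - act A Z := by
  funext m
  simp [act, smul_sub, Finset.sum_sub_distrib]

theorem act_smul (A : Matrix (Fin n) (Fin n) ℝ) (c : ℝ) (W : Fin n → Vec d) :
    act A (c • W) = c • act A W := by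
  funext m
  simp only [act, Pi.smul_apply, Finset.smul_sum]
  exact Finset.sum_congr rfl fun l _ => smul_comm _ _ _

theorem sub_act (A B : Matrix (Fin n) (Fin n) ℝ) (W : Fin n → Vec d) :
    act (A - B) W = act A W - act B W := by
  funext m
  simp [act, sub_smul, Finset.sum_sub_distrib]

theorem act_mul (A B : Matrix (Fin n) (Fin n) ℝ) (W : Fin n → Vec d) :
    act (A * B) W = act A (act B W) := by
  funext m
  simp only [act, Matrix.mul_apply, Finset.sum_smul, Finset.smul_sum, smul_smul]
  exact Finset.sum_comm

theorem sum_vecMul_smul (c : Fin n → ℝ) (A : Matrix (Fin n) (Fin n) ℝ) (W : Fin n → Vec d) :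
    ∑ m, (Matrix.vecMul c A) m • W m = ∑ l, c l • act A W l := by
  simp only [act, Matrix.vecMul, dotProduct, Finset.sum_smul, Finset.smul_sum, smul_smul]
  exact Finset.sum_comm

theorem norm_force_sub_le (hf : LipschitzWith L f) (X V X' V' : Fin n → Vec d) :
    ‖force f X V - force f X' V'‖ ≤ L * max ‖X - X'‖ ‖V - V'‖ := by
  rw [pi_norm_le_iff_of_nonneg (by positivity)]
  intro m
  refine (hf.norm_sub_le _ _).trans ?_
  gcongr
  exact max_le_max (norm_le_pi_norm (X - X') m) (norm_le_pi_norm (V - V') m)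

theorem norm_force_sub_le_of_indep (hf : LipschitzWith L f)
    (hind : ∀ y w w', f (y, w) = f (y, w')) (X V X' V' : Fin n → Vec d) :
    ‖force f X V - force f X' V'‖ ≤ L * ‖X - X'‖ := by
  have h1 : force f X' V' = force f X' V := funext fun m => hind _ _ _
  have h2 := norm_force_sub_le hf X V X' V
  rwa [← h1, sub_self, norm_zero, max_eq_left (norm_nonneg _)] at h2

/-- The implicit equations which are common to collocation and to SDC iterations. -/
def IsImplicitSolution (A B : Matrix (Fin n) (Fin n) ℝ) (f : Vec d × Vec d → Vec d) (h : ℝ)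
    (a b X V : Fin n → Vec d) : Prop :=
  X = a + h ^ 2 • act A (force f X V) ∧ V = b + h • act B (force f X V)

theorem isCollocationSolution_iff {x₀ v₀ : Vec d} {X V : Fin (M + 1) → Vec d} :
    IsCollocationSolution e f h x₀ v₀ X V ↔ IsImplicitSolution (Q e * Q e) (Q e) f h
      ((fun _ => x₀) + h • act (Q e) (fun _ => v₀)) (fun _ => v₀) X V := Iff.rfl

theorem isSweep_iff {x₀ v₀ : Vec d} {X V X' V' : Fin (M + 1) → Vec d} :
    IsSweep e f h x₀ v₀ X V X' V' ↔ IsImplicitSolution (Qx e) (QT e) f h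
      ((fun _ => x₀) + h • act (Q e) (fun _ => v₀) +
        h ^ 2 • act (Q e * Q e - Qx e) (force f X V))
      ((fun _ => v₀) + h • act (Q e - QT e) (force f X V)) X' V' := by
  unfold IsSweep IsImplicitSolution
  rw [sub_eq_iff_eq_add, sub_eq_iff_eq_add]

/-- The matrices `Qx` and `QT` occur on both sides and cancel. The sweep error thus becomes the
difference of two solutions of one implicit system with different data. -/
theorem IsCollocationSolution.isSweep {x₀ v₀ : Vec d} {X V : Fin (M + 1) → Vec d}
    (hc : IsCollocationSolution e f h x₀ v₀ X V) : IsSweep e f h x₀ v₀ X V X V := by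
  obtain ⟨h1, h2⟩ := hc
  constructor
  · nth_rewrite 1 [h1]
    rw [sub_act, smul_sub]
    abel
  · nth_rewrite 1 [h2]
    rw [sub_act, smul_sub]
    abel

variable {A B : Matrix (Fin n) (Fin n) ℝ} {a b X V a' b' X' V' : Fin n → Vec d}

theorem norm_smul_act_force_le (hf : LipschitzWith L f) (h0 : 0 < h)
    (A : Matrix (Fin n) (Fin n) ℝ) (X V X' V' : Fin n → Vec d) :
    ‖h • act A (force f X V) - h • act A (force f X' V')‖ ≤
      h * (L * entrySum A) * max ‖X - X'‖ ‖V - V'‖ := by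
  rw [← smul_sub, ← act_sub, norm_smul, Real.norm_of_nonneg h0.le]
  calc h * ‖act A (force f X V - force f X' V')‖
      ≤ h * (entrySum A * (L * max ‖X - X'‖ ‖V - V'‖)) := by
        gcongr
        refine (norm_act_le _ _).trans ?_
        exact mul_le_mul_of_nonneg_left (norm_force_sub_le hf _ _ _ _) (entrySum_nonneg A)
    _ = _ := by ring

theorem norm_sq_smul_act_force_le (hf : LipschitzWith L f) (h0 : 0 < h) (h1 : h ≤ 1)
    (A : Matrix (Fin n) (Fin n) ℝ) (X V X' V' : Fin n → Vec d) :
    ‖h ^ 2 • act A (force f X V) - h ^ 2 • act A (force f X' V')‖ ≤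
      h * (L * entrySum A) * max ‖X - X'‖ ‖V - V'‖ := by
  have hA := entrySum_nonneg A
  refine (norm_smul_act_force_le hf (by positivity) A X V X' V').trans ?_
  gcongr
  nlinarith

/-- The smallness condition makes the implicit force terms at most half of the difference itself, so
they can be absorbed. -/
theorem IsImplicitSolution.max_norm_sub_le (hf : LipschitzWith L f) (h0 : 0 < h) (h1 : h ≤ 1)
    (hs : h * (L * (entrySum A + entrySum B)) ≤ 1 / 2)
    (hX : IsImplicitSolution A B f h a b X V) (hX' : IsImplicitSolution A B f h a' b' X' V') :
    max ‖X - X'‖ ‖V - V'‖ ≤ 2 * max ‖a - a'‖ ‖b - b'‖ := by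
  have hA := entrySum_nonneg A
  have hB := entrySum_nonneg B
  set δ := max ‖X - X'‖ ‖V - V'‖ with hδ
  have hδ0 : 0 ≤ δ := le_max_of_le_left (norm_nonneg _)
  have e1 : X - X' = (a - a') +
      (h ^ 2 • act A (force f X V) - h ^ 2 • act A (force f X' V')) := by
    nth_rewrite 1 [hX.1, hX'.1]
    abel
  have e2 : V - V' = (b - b') + (h • act B (force f X V) - h • act B (force f X' V')) := by
    nth_rewrite 1 [hX.2, hX'.2]
    abel
  have b1 : ‖X - X'‖ ≤ max ‖a - a'‖ ‖b - b'‖ + 1 / 2 * δ := by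
    rw [e1]
    refine (norm_add_le _ _).trans (add_le_add (le_max_left _ _) ?_)
    refine (norm_sq_smul_act_force_le hf h0 h1 A X V X' V').trans ?_
    refine mul_le_mul_of_nonneg_right (le_trans ?_ hs) hδ0
    gcongr
    linarith
  have b2 : ‖V - V'‖ ≤ max ‖a - a'‖ ‖b - b'‖ + 1 / 2 * δ := by
    rw [e2]
    refine (norm_add_le _ _).trans (add_le_add (le_max_right _ _) ?_)
    refine (norm_smul_act_force_le hf h0 B X V X' V').trans ?_
    refine mul_le_mul_of_nonneg_right (le_trans ?_ hs) hδ0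
    gcongr
    linarith
  have := max_le b1 b2
  linarith

/-- Without velocity dependence `V'` may be replaced by `V` inside the force, so the velocity data
`b`, `b'` do not enter the position error. -/
theorem IsImplicitSolution.norm_sub_le_of_indep (hf : LipschitzWith L f)
    (hind : ∀ y w w', f (y, w) = f (y, w')) (h0 : 0 < h) (h1 : h ≤ 1)
    (hs : h * (L * (entrySum A + entrySum B)) ≤ 1 / 2)
    (hX : IsImplicitSolution A B f h a b X V) (hX' : IsImplicitSolution A B f h a' b' X' V') :
    ‖X - X'‖ ≤ 2 * ‖a - a'‖ := by
  have hA := entrySum_nonneg A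
  have hB := entrySum_nonneg B
  have e1 : X - X' = (a - a') +
      (h ^ 2 • act A (force f X V) - h ^ 2 • act A (force f X' V')) := by
    nth_rewrite 1 [hX.1, hX'.1]
    abel
  have hV : force f X' V' = force f X' V := funext fun m => hind _ _ _
  have b1 := norm_sq_smul_act_force_le hf h0 h1 A X V X' V
  rw [← hV, sub_self, norm_zero, max_eq_left (norm_nonneg _)] at b1
  have b2 : h * (L * entrySum A) * ‖X - X'‖ ≤ 1 / 2 * ‖X - X'‖ := by
    refine mul_le_mul_of_nonneg_right (le_trans ?_ hs) (norm_nonneg _)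
    gcongr
    linarith
  have b3 : ‖X - X'‖ ≤ ‖a - a'‖ + 1 / 2 * ‖X - X'‖ := by
    nth_rewrite 1 [e1]
    exact (norm_add_le _ _).trans (by linarith)
  linarith

theorem IsImplicitSolution.unique (hf : LipschitzWith L f) (h0 : 0 < h) (h1 : h ≤ 1)
    (hs : h * (L * (entrySum A + entrySum B)) ≤ 1 / 2)
    (hX : IsImplicitSolution A B f h a b X V) (hX' : IsImplicitSolution A B f h a b X' V') :
    X = X' ∧ V = V' := by
  have := hX.max_norm_sub_le hf h0 h1 hs hX'
  simp only [sub_self, norm_zero, max_self, mul_zero, max_le_iff, norm_le_zero_iff,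
    sub_eq_zero] at this
  exact this

theorem exists_isImplicitSolution (hf : LipschitzWith L f) (h0 : 0 < h) (h1 : h ≤ 1)
    (hs : h * (L * (entrySum A + entrySum B)) ≤ 1 / 2) (a b : Fin n → Vec d) :
    ∃ X V, IsImplicitSolution A B f h a b X V := by
  have hA := entrySum_nonneg A
  have hB := entrySum_nonneg B
  let Φ : (Fin n → Vec d) × (Fin n → Vec d) → (Fin n → Vec d) × (Fin n → Vec d) := fun W =>
    (a + h ^ 2 • act A (force f W.1 W.2), b + h • act B (force f W.1 W.2))
  have hΦ : ContractingWith (1 / 2) Φ := by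
    refine ⟨by norm_num, LipschitzWith.of_dist_le_mul fun W Z => ?_⟩
    rw [dist_eq_norm, dist_eq_norm]
    have hWZ : ‖W - Z‖ = max ‖W.1 - Z.1‖ ‖W.2 - Z.2‖ := rfl
    rw [hWZ]
    have hδ0 : 0 ≤ max ‖W.1 - Z.1‖ ‖W.2 - Z.2‖ := le_max_of_le_left (norm_nonneg _)
    have hc : ((1 / 2 : NNReal) : ℝ) = 1 / 2 := by norm_num
    rw [hc]
    refine max_le ?_ ?_
    · simp only [Φ, Prod.fst_sub, add_sub_add_left_eq_sub]
      refine (norm_sq_smul_act_force_le hf h0 h1 A _ _ _ _).trans ?_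
      refine mul_le_mul_of_nonneg_right (le_trans ?_ hs) hδ0
      gcongr
      linarith
    · simp only [Φ, Prod.snd_sub, add_sub_add_left_eq_sub]
      refine (norm_smul_act_force_le hf h0 B _ _ _ _).trans ?_
      refine mul_le_mul_of_nonneg_right (le_trans ?_ hs) hδ0
      gcongr
      linarith
  have hfix := hΦ.fixedPoint_isFixedPt
  exact ⟨_, _, (congrArg Prod.fst hfix).symm, (congrArg Prod.snd hfix).symm⟩

end Discrete

/-! ### Well-posedness and Lipschitz stability of a time step -/

section Steps

variable {M d : ℕ} {e : Fin M → ℝ} {f : Vec d × Vec d → Vec d} {L : NNReal} {h : ℝ} {k : ℕ}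

/-- Step sizes for which the equations of collocation and of the SDC iterations are contractive. -/
structure SmallStep (e : Fin M → ℝ) (L : NNReal) (h : ℝ) : Prop where
  pos : 0 < h
  le_one : h ≤ 1
  collocation : h * (L * (entrySum (Q e * Q e) + entrySum (Q e))) ≤ 1 / 2
  sweep : h * (L * (entrySum (Qx e) + entrySum (QT e))) ≤ 1 / 2

theorem exists_smallStep (e : Fin M → ℝ) (L : NNReal) :
    ∃ h₀ : ℝ, 0 < h₀ ∧ ∀ h, 0 < h → h ≤ h₀ → SmallStep e L h := by
  set K₁ : ℝ := L * (entrySum (Q e * Q e) + entrySum (Q e)) with hK₁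
  set K₂ : ℝ := L * (entrySum (Qx e) + entrySum (QT e)) with hK₂
  have h1 : 0 ≤ K₁ := mul_nonneg L.2 (add_nonneg (entrySum_nonneg _) (entrySum_nonneg _))
  have h2 : 0 ≤ K₂ := mul_nonneg L.2 (add_nonneg (entrySum_nonneg _) (entrySum_nonneg _))
  refine ⟨1 / (2 * (K₁ + K₂ + 1)), by positivity, fun h h0 hh => ?_⟩
  rw [le_div_iff₀ (by positivity)] at hh
  exact ⟨h0, by nlinarith, by nlinarith, by nlinarith⟩

/-- The iterates `(X i, V i)`, `i ≤ k`, of SDC. -/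
def IsIteration (e : Fin M → ℝ) (f : Vec d × Vec d → Vec d) (k : ℕ) (h : ℝ) (x₀ v₀ : Vec d)
    (X V : ℕ → Fin (M + 1) → Vec d) : Prop :=
  ∀ i < k, IsSweep e f h x₀ v₀ (X i) (V i) (X (i + 1)) (V (i + 1))

/-- The values at the end of a step for given forces at the nodes. -/
noncomputable def stepEnd (e : Fin M → ℝ) (h : ℝ) (x₀ v₀ : Vec d) (W : Fin (M + 1) → Vec d) :
    Vec d × Vec d :=
  (x₀ + h • ∑ m, q e m • v₀ + h ^ 2 • ∑ m, (Matrix.vecMul (q e) (Q e)) m • W m,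
    v₀ + h • ∑ m, q e m • W m)

theorem isStep_iff {X₀ V₀ : Fin (M + 1) → Vec d} {x₀ v₀ : Vec d} {u : Vec d × Vec d} :
    IsStep e f k h X₀ V₀ x₀ v₀ u.1 u.2 ↔ ∃ X V : ℕ → Fin (M + 1) → Vec d,
      X 0 = X₀ ∧ V 0 = V₀ ∧ IsIteration e f k h x₀ v₀ X V ∧
        u = stepEnd e h x₀ v₀ (force f (X k) (V k)) := by
  simp only [IsStep, IsIteration, stepEnd, force, Prod.ext_iff]

theorem exists_isIteration (hf : LipschitzWith L f) (hs : SmallStep e L h)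
    (X₀ V₀ : Fin (M + 1) → Vec d) (x₀ v₀ : Vec d) :
    ∃ X V : ℕ → Fin (M + 1) → Vec d, X 0 = X₀ ∧ V 0 = V₀ ∧ IsIteration e f k h x₀ v₀ X V := by
  have hex : ∀ W : (Fin (M + 1) → Vec d) × (Fin (M + 1) → Vec d),
      ∃ W' : (Fin (M + 1) → Vec d) × (Fin (M + 1) → Vec d),
        IsSweep e f h x₀ v₀ W.1 W.2 W'.1 W'.2 := by
    intro W
    obtain ⟨X, V, hXV⟩ := exists_isImplicitSolution hf hs.pos hs.le_one hs.sweep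
      ((fun _ => x₀) + h • act (Q e) (fun _ => v₀) +
        h ^ 2 • act (Q e * Q e - Qx e) (force f W.1 W.2))
      ((fun _ => v₀) + h • act (Q e - QT e) (force f W.1 W.2))
    exact ⟨(X, V), isSweep_iff.2 hXV⟩
  choose Ψ hΨ using hex
  refine ⟨fun i => (Ψ^[i] (X₀, V₀)).1, fun i => (Ψ^[i] (X₀, V₀)).2, rfl, rfl, fun i _ => ?_⟩
  simp only [Function.iterate_succ_apply']
  exact hΨ _

theorem IsIteration.unique (hf : LipschitzWith L f) (hs : SmallStep e L h)
    {x₀ v₀ : Vec d} {X V X' V' : ℕ → Fin (M + 1) → Vec d} (hX : IsIteration e f k h x₀ v₀ X V)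
    (hX' : IsIteration e f k h x₀ v₀ X' V') (hX0 : X 0 = X' 0) (hV0 : V 0 = V' 0) (i : ℕ)
    (hi : i ≤ k) : X i = X' i ∧ V i = V' i := by
  induction i with
  | zero => exact ⟨hX0, hV0⟩
  | succ i ih =>
    obtain ⟨e1, e2⟩ := ih (Nat.le_of_succ_le hi)
    have s1 := isSweep_iff.1 (hX i hi)
    have s2 := isSweep_iff.1 (hX' i hi)
    rw [e1, e2] at s1
    exact s1.unique hf hs.pos hs.le_one hs.sweep s2

/-- The step relation is the graph of a map; existence and uniqueness of the whole run then follow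
by recursion. -/
theorem exists_stepMap (hf : LipschitzWith L f) (hs : SmallStep e L h) (k : ℕ)
    (X₀ V₀ : Fin (M + 1) → Vec d) (x₀ v₀ : Vec d) :
    ∃ w : Vec d × Vec d, ∀ u : Vec d × Vec d, IsStep e f k h X₀ V₀ x₀ v₀ u.1 u.2 ↔ u = w := by
  obtain ⟨X, V, hX0, hV0, hit⟩ := exists_isIteration (k := k) hf hs X₀ V₀ x₀ v₀
  refine ⟨stepEnd e h x₀ v₀ (force f (X k) (V k)), fun u => ?_⟩
  rw [isStep_iff]
  constructor
  · rintro ⟨X', V', hX0', hV0', hit', rfl⟩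
    obtain ⟨e1, e2⟩ := hit.unique hf hs hit' (hX0.trans hX0'.symm) (hV0.trans hV0'.symm) k le_rfl
    rw [e1, e2]
  · exact fun hu => ⟨X, V, hX0, hV0, hit, hu⟩

theorem existsUnique_isRun (hf : LipschitzWith L f) (hs : SmallStep e L h) (S : Starter M d)
    (x₀ v₀ : Vec d) : ∃! u, IsRun e f k S h x₀ v₀ u := by
  have hstep (n : ℕ) (z : Vec d × Vec d) := exists_stepMap hf hs k (S h n z.1 z.2).1
    (S h n z.1 z.2).2 z.1 z.2
  choose Ψ hΨ using hstep
  refine ⟨fun n => Nat.rec (x₀, v₀) Ψ n, ⟨rfl, fun n => (hΨ n _ _).2 rfl⟩, fun u hu => ?_⟩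
  funext n
  induction n with
  | zero => exact hu.1
  | succ n ih =>
    have := (hΨ n _ _).1 (hu.2 n)
    rw [this, ih]

/-- A constant for the effect of the forces at the nodes on the values at the end of a step. -/
noncomputable def endSum (e : Fin M → ℝ) : ℝ :=
  (∑ m, |q e m|) + ∑ m, |(Matrix.vecMul (q e) (Q e)) m|

theorem endSum_nonneg (e : Fin M → ℝ) : 0 ≤ endSum e :=
  add_nonneg (Finset.sum_nonneg fun _ _ => abs_nonneg _) (Finset.sum_nonneg fun _ _ => abs_nonneg _)

/-- The factor `h` in front of the force difference is the extra power that a local error needs over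
the global order. -/
theorem norm_stepEnd_sub_le (h0 : 0 < h) (h1 : h ≤ 1) (x₀ v₀ x₁ v₁ : Vec d)
    (W Z : Fin (M + 1) → Vec d) :
    ‖stepEnd e h x₀ v₀ W - stepEnd e h x₁ v₁ Z‖ ≤
      (1 + h * endSum e) * ‖(x₀, v₀) - (x₁, v₁)‖ + h * endSum e * ‖W - Z‖ := by
  have hp : 0 ≤ ∑ m, |q e m| := Finset.sum_nonneg fun _ _ => abs_nonneg _
  have hq : 0 ≤ ∑ m, |(Matrix.vecMul (q e) (Q e)) m| := Finset.sum_nonneg fun _ _ => abs_nonneg _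
  set ε := ‖(x₀, v₀) - (x₁, v₁)‖ with hε
  have hx : ‖x₀ - x₁‖ ≤ ε := le_max_left _ _
  have hv : ‖v₀ - v₁‖ ≤ ε := le_max_right _ _
  have hε0 : 0 ≤ ε := norm_nonneg _
  have hqv : ‖∑ m, q e m • (v₀ - v₁)‖ ≤ (∑ m, |q e m|) * ε := by
    rw [Finset.sum_mul]
    refine norm_sum_le_of_le _ fun m _ => ?_
    rw [norm_smul, Real.norm_eq_abs]
    gcongr
  have hF1 := norm_sum_smul_le (q e) (W - Z)
  have hF2 := norm_sum_smul_le (Matrix.vecMul (q e) (Q e)) (W - Z)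
  have hWZ := norm_nonneg (W - Z)
  refine max_le ?_ ?_
  · have : (stepEnd e h x₀ v₀ W - stepEnd e h x₁ v₁ Z).1 = (x₀ - x₁) +
        h • ∑ m, q e m • (v₀ - v₁) +
        h ^ 2 • ∑ m, (Matrix.vecMul (q e) (Q e)) m • (W - Z) m := by
      simp only [stepEnd, Prod.fst_sub, Pi.sub_apply, smul_sub, Finset.sum_sub_distrib]
      abel
    rw [this]
    refine (norm_add₃_le).trans ?_
    rw [norm_smul, norm_smul, Real.norm_of_nonneg h0.le, Real.norm_of_nonneg (by positivity)]
    have h2 : h ^ 2 ≤ h := by nlinarith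
    calc _ ≤ ε + h * ((∑ m, |q e m|) * ε) +
          h * ((∑ m, |(Matrix.vecMul (q e) (Q e)) m|) * ‖W - Z‖) := by gcongr
      _ ≤ _ := by
        unfold endSum
        have t1 := mul_nonneg h0.le (mul_nonneg hp hWZ)
        have t2 := mul_nonneg h0.le (mul_nonneg hq hε0)
        linarith
  · have : (stepEnd e h x₀ v₀ W - stepEnd e h x₁ v₁ Z).2 = (v₀ - v₁) +
        h • ∑ m, q e m • (W - Z) m := by
      simp only [stepEnd, Prod.snd_sub, Pi.sub_apply, smul_sub, Finset.sum_sub_distrib]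
      abel
    rw [this]
    refine (norm_add_le _ _).trans ?_
    rw [norm_smul, Real.norm_of_nonneg h0.le]
    calc _ ≤ ε + h * ((∑ m, |q e m|) * ‖W - Z‖) := by gcongr
      _ ≤ _ := by
        unfold endSum
        have t1 := mul_nonneg h0.le (mul_nonneg hq hWZ)
        have t2 := mul_nonneg h0.le (mul_nonneg hq hε0)
        have t3 := mul_nonneg h0.le (mul_nonneg hp hε0)
        linarith

theorem exists_isCollocationSolution (hf : LipschitzWith L f) (hs : SmallStep e L h)
    (x₀ v₀ : Vec d) : ∃ X V, IsCollocationSolution e f h x₀ v₀ X V :=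
  exists_isImplicitSolution hf hs.pos hs.le_one hs.collocation _ _

/-- The collocation step depends Lipschitz continuously on the values at its beginning. -/
theorem collocation_step_lipschitz (hf : LipschitzWith L f) (hs : SmallStep e L h)
    {x₀ v₀ x₁ v₁ : Vec d} {X V X' V' : Fin (M + 1) → Vec d}
    (hX : IsCollocationSolution e f h x₀ v₀ X V)
    (hX' : IsCollocationSolution e f h x₁ v₁ X' V') :
    ‖stepEnd e h x₀ v₀ (force f X V) - stepEnd e h x₁ v₁ (force f X' V')‖ ≤
      (1 + endSum e * (1 + 2 * L * (1 + entrySum (Q e))) * h) * ‖(x₀, v₀) - (x₁, v₁)‖ := by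
  have h0 := hs.pos
  have hQ := entrySum_nonneg (Q e)
  have hE := endSum_nonneg e
  set ε := ‖(x₀, v₀) - (x₁, v₁)‖ with hε
  have hx : ‖x₀ - x₁‖ ≤ ε := le_max_left _ _
  have hv : ‖v₀ - v₁‖ ≤ ε := le_max_right _ _
  have hε0 : 0 ≤ ε := norm_nonneg _
  have hcx : ‖(fun _ : Fin (M + 1) => x₀) - fun _ => x₁‖ ≤ ε := by
    rw [pi_norm_le_iff_of_nonneg hε0]
    exact fun _ => hx
  have hcv : ‖(fun _ : Fin (M + 1) => v₀) - fun _ => v₁‖ ≤ ε := by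
    rw [pi_norm_le_iff_of_nonneg hε0]
    exact fun _ => hv
  have hmax := (isCollocationSolution_iff.1 hX).max_norm_sub_le hf h0 hs.le_one hs.collocation
    (isCollocationSolution_iff.1 hX')
  have ha : ‖(fun _ : Fin (M + 1) => x₀) + h • act (Q e) (fun _ => v₀) -
      ((fun _ => x₁) + h • act (Q e) (fun _ => v₁))‖ ≤ (1 + entrySum (Q e)) * ε := by
    rw [add_sub_add_comm, ← smul_sub, ← act_sub]
    refine (norm_add_le _ _).trans ?_
    rw [norm_smul, Real.norm_of_nonneg h0.le]
    have h1 : ‖act (Q e) ((fun _ => v₀) - fun _ => v₁)‖ ≤ entrySum (Q e) * ε :=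
      (norm_act_le _ _).trans (by gcongr)
    have h2 := mul_le_mul hs.le_one h1 (norm_nonneg _) zero_le_one
    linarith
  have hb : ‖(fun _ : Fin (M + 1) => v₀) - fun _ => v₁‖ ≤ (1 + entrySum (Q e)) * ε :=
    hcv.trans (by nlinarith)
  have hF := norm_force_sub_le hf X V X' V'
  have hF' : ‖force f X V - force f X' V'‖ ≤ 2 * L * (1 + entrySum (Q e)) * ε := by
    calc _ ≤ L * (2 * ((1 + entrySum (Q e)) * ε)) := by
          refine hF.trans ?_
          gcongr
          refine hmax.trans ?_
          gcongr
          exact max_le ha hb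
      _ = _ := by ring
  refine (norm_stepEnd_sub_le h0 hs.le_one _ _ _ _ _ _).trans ?_
  calc _ ≤ (1 + h * endSum e) * ε + h * endSum e * (2 * L * (1 + entrySum (Q e)) * ε) := by gcongr
    _ = _ := by ring

end Steps

end SDC

namespace SDC

/-! ### Contraction of the sweeps towards collocation -/

section Sweeps

variable {M d : ℕ} {e : Fin M → ℝ} {f : Vec d × Vec d → Vec d} {L : NNReal} {h : ℝ} {k : ℕ}
  {x₀ v₀ : Vec d} {X V : Fin (M + 1) → Vec d}

/-- Both `(X, V)` and the new iterate solve the sweep equations. Their data differ only by force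
differences weighted with `h ^ 2` and `h`, and the velocity weight `h` is the bottleneck. -/
theorem IsCollocationSolution.max_norm_sub_sweep_le (hf : LipschitzWith L f)
    (hs : SmallStep e L h) (hX : IsCollocationSolution e f h x₀ v₀ X V)
    {X₀ V₀ X₁ V₁ : Fin (M + 1) → Vec d} (hsw : IsSweep e f h x₀ v₀ X₀ V₀ X₁ V₁) :
    max ‖X - X₁‖ ‖V - V₁‖ ≤
      2 * L * (entrySum (Q e * Q e - Qx e) + entrySum (Q e - QT e)) * h *
        max ‖X - X₀‖ ‖V - V₀‖ := by
  have h0 := hs.pos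
  have hA := entrySum_nonneg (Q e * Q e - Qx e)
  have hB := entrySum_nonneg (Q e - QT e)
  have hδ0 : 0 ≤ max ‖X - X₀‖ ‖V - V₀‖ := le_max_of_le_left (norm_nonneg _)
  have h1 := (isSweep_iff.1 hX.isSweep).max_norm_sub_le hf h0 hs.le_one hs.sweep
    (isSweep_iff.1 hsw)
  rw [add_sub_add_left_eq_sub, add_sub_add_left_eq_sub] at h1
  have h2 := norm_sq_smul_act_force_le hf h0 hs.le_one (Q e * Q e - Qx e) X V X₀ V₀
  have h3 := norm_smul_act_force_le hf h0 (Q e - QT e) X V X₀ V₀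
  have t1 := mul_nonneg (mul_nonneg h0.le (mul_nonneg L.2 hA)) hδ0
  have t2 := mul_nonneg (mul_nonneg h0.le (mul_nonneg L.2 hB)) hδ0
  refine h1.trans ?_
  have h4 := max_le (h2.trans (le_add_of_nonneg_right t2)) (h3.trans (le_add_of_nonneg_left t1))
  refine (mul_le_mul_of_nonneg_left h4 zero_le_two).trans (le_of_eq ?_)
  simp only [NNReal.val_eq_coe]
  ring

/-- Only the position equation is involved here, so its full factor `h ^ 2` survives: two orders per
sweep. -/
theorem IsCollocationSolution.norm_sub_sweep_le_of_indep (hf : LipschitzWith L f)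
    (hind : ∀ y w w', f (y, w) = f (y, w'))
    (hs : SmallStep e L h) (hX : IsCollocationSolution e f h x₀ v₀ X V)
    {X₀ V₀ X₁ V₁ : Fin (M + 1) → Vec d} (hsw : IsSweep e f h x₀ v₀ X₀ V₀ X₁ V₁) :
    ‖X - X₁‖ ≤ 2 * L * entrySum (Q e * Q e - Qx e) * h ^ 2 * ‖X - X₀‖ := by
  have h0 := hs.pos
  have h1 := (isSweep_iff.1 hX.isSweep).norm_sub_le_of_indep hf hind h0 hs.le_one hs.sweep
    (isSweep_iff.1 hsw)
  rw [add_sub_add_left_eq_sub] at h1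
  have hV : force f X₀ V₀ = force f X₀ V := funext fun m => hind _ _ _
  have h2 := norm_smul_act_force_le hf (pow_pos h0 2) (Q e * Q e - Qx e) X V X₀ V
  rw [← hV, sub_self, norm_zero, max_eq_left (norm_nonneg _)] at h2
  refine h1.trans ?_
  refine (mul_le_mul_of_nonneg_left h2 zero_le_two).trans (le_of_eq ?_)
  ring

theorem le_pow_mul_of_le_mul {δ : ℕ → ℝ} {c : ℝ} (hc : 0 ≤ c)
    (hδ : ∀ i < k, δ (i + 1) ≤ c * δ i) : δ k ≤ c ^ k * δ 0 := by
  induction k with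
  | zero => simp
  | succ k ih =>
    calc δ (k + 1) ≤ c * δ k := hδ k (Nat.lt_succ_self k)
      _ ≤ c * (c ^ k * δ 0) := by
        gcongr
        exact ih fun i hi => hδ i (hi.trans (Nat.lt_succ_self k))
      _ = c ^ (k + 1) * δ 0 := by ring

/-- The forces computed by `k` SDC iterations agree with those of collocation up to `O(h ^ s)`,
locally uniformly in the values at the beginning of the step. -/
def ForceOrder (e : Fin M → ℝ) (f : Vec d × Vec d → Vec d) (k : ℕ) (S : Starter M d) (s : ℕ) :
    Prop :=
  ∀ R : ℝ, ∃ C h₀ : ℝ, 0 ≤ C ∧ 0 < h₀ ∧ ∀ h, 0 < h → h ≤ h₀ → ∀ (n : ℕ) (x₀ v₀ : Vec d),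
    ‖x₀‖ ≤ R → ‖v₀‖ ≤ R → ∀ X V, IsCollocationSolution e f h x₀ v₀ X V →
      ∀ X' V' : ℕ → Fin (M + 1) → Vec d, X' 0 = (S h n x₀ v₀).1 → V' 0 = (S h n x₀ v₀).2 →
        IsIteration e f k h x₀ v₀ X' V' →
        ‖force f X V - force f (X' k) (V' k)‖ ≤ C * h ^ s

theorem StarterOrder.forceOrder (hf : LipschitzWith L f) {S : Starter M d} {k₀ : ℕ}
    (hS : StarterOrder e f S k₀) (k : ℕ) : ForceOrder e f k S (k + k₀) := by
  intro R
  obtain ⟨C₀, h₀, hh₀, hC₀⟩ := hS R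
  obtain ⟨h₁, hh₁, hsm⟩ := exists_smallStep e L
  set c : ℝ := 2 * L * (entrySum (Q e * Q e - Qx e) + entrySum (Q e - QT e)) with hc
  have hc0 : 0 ≤ c := mul_nonneg (by positivity)
    (add_nonneg (entrySum_nonneg _) (entrySum_nonneg _))
  refine ⟨L * (c ^ k * |C₀|), min h₀ h₁, by positivity, lt_min hh₀ hh₁, ?_⟩
  intro h h0 hh n x₀ v₀ hx₀ hv₀ X V hXV X' V' hX' hV' hit
  have hs := hsm h h0 (hh.trans (min_le_right _ _))
  have hst := hC₀ h h0 (hh.trans (min_le_left _ _)) n x₀ v₀ hx₀ hv₀ X V hXV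
  have hle : C₀ * h ^ k₀ ≤ |C₀| * h ^ k₀ := by
    gcongr
    exact le_abs_self C₀
  have hδ0 : max ‖X - X' 0‖ ‖V - V' 0‖ ≤ |C₀| * h ^ k₀ := by
    refine max_le ?_ ?_ <;> rw [pi_norm_le_iff_of_nonneg (by positivity)] <;> intro m
    · rw [hX']
      exact (hst m).1.trans hle
    · rw [hV']
      exact (hst m).2.trans hle
  have hk := le_pow_mul_of_le_mul (k := k) (δ := fun i => max ‖X - X' i‖ ‖V - V' i‖)
    (c := c * h) (by positivity) fun i hi => hXV.max_norm_sub_sweep_le hf hs (hit i hi)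
  calc _ ≤ L * max ‖X - X' k‖ ‖V - V' k‖ := norm_force_sub_le hf _ _ _ _
    _ ≤ L * ((c * h) ^ k * (|C₀| * h ^ k₀)) := by
        gcongr
        exact hk.trans (by gcongr)
    _ = _ := by ring

theorem StarterOrder.forceOrder_of_indep (hf : LipschitzWith L f)
    (hind : ∀ y w w', f (y, w) = f (y, w')) {S : Starter M d} {k₀ : ℕ}
    (hS : StarterOrder e f S k₀) (k : ℕ) : ForceOrder e f k S (2 * k + k₀) := by
  intro R
  obtain ⟨C₀, h₀, hh₀, hC₀⟩ := hS R
  obtain ⟨h₁, hh₁, hsm⟩ := exists_smallStep e L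
  set c : ℝ := 2 * L * entrySum (Q e * Q e - Qx e) with hc
  have hc0 : 0 ≤ c := mul_nonneg (by positivity) (entrySum_nonneg _)
  refine ⟨L * (c ^ k * |C₀|), min h₀ h₁, by positivity, lt_min hh₀ hh₁, ?_⟩
  intro h h0 hh n x₀ v₀ hx₀ hv₀ X V hXV X' V' hX' hV' hit
  have hs := hsm h h0 (hh.trans (min_le_right _ _))
  have hst := hC₀ h h0 (hh.trans (min_le_left _ _)) n x₀ v₀ hx₀ hv₀ X V hXV
  have hδ0 : ‖X - X' 0‖ ≤ |C₀| * h ^ k₀ := by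
    rw [pi_norm_le_iff_of_nonneg (by positivity)]
    intro m
    rw [hX']
    refine (hst m).1.trans ?_
    gcongr
    exact le_abs_self C₀
  have hk := le_pow_mul_of_le_mul (k := k) (δ := fun i => ‖X - X' i‖)
    (c := c * h ^ 2) (by positivity) fun i hi =>
      hXV.norm_sub_sweep_le_of_indep hf hind hs (hit i hi)
  calc _ ≤ L * ‖X - X' k‖ := norm_force_sub_le_of_indep hf hind _ _ _ _
    _ ≤ L * ((c * h ^ 2) ^ k * (|C₀| * h ^ k₀)) := by
        gcongr
        exact hk.trans (by gcongr)
    _ = _ := by ring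

end Sweeps

/-! ### Reduction of second-order collocation to a first-order system -/

section FirstOrder

variable {M d : ℕ} {e : Fin M → ℝ} {f : Vec d × Vec d → Vec d} {L : NNReal} {h : ℝ}
  {x₀ v₀ : Vec d} {X V : Fin (M + 1) → Vec d}

/-- The right-hand side of the first-order system for `(x, v)`. -/
def field (f : Vec d × Vec d → Vec d) (y : Vec d × Vec d) : Vec d × Vec d := (y.2, f y)

theorem lipschitzWith_field (hf : LipschitzWith L f) : LipschitzWith (max 1 L) (field f) :=
  LipschitzWith.prodMk LipschitzWith.prod_snd hf

theorem act_Q_succ (W : Fin (M + 1) → Vec d) (j : Fin M) :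
    act (Q e) W j.succ = ∑ k, weight e (e j) k • W k.succ := by
  simp [act, Q, Fin.sum_univ_succ]

theorem sum_q_smul (W : Fin (M + 1) → Vec d) :
    ∑ m, q e m • W m = ∑ k, weight e 1 k • W k.succ := by
  simp [q, Fin.sum_univ_succ]

/-- Applying `Q` to the velocity equation yields exactly the terms with `v₀` and `Q * Q` in the
position equation. -/
theorem IsCollocationSolution.fst_eq (hX : IsCollocationSolution e f h x₀ v₀ X V) :
    X = (fun _ => x₀) + h • act (Q e) V := by
  have h2 : act (Q e) V = act (Q e) (fun _ => v₀) + h • act (Q e * Q e) (force f X V) := by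
    nth_rewrite 1 [hX.2]
    rw [act_add, act_smul, act_mul]
  rw [h2]
  nth_rewrite 1 [hX.1]
  rw [smul_add, smul_smul, ← sq h, add_assoc]

theorem IsCollocationSolution.node_eq (hX : IsCollocationSolution e f h x₀ v₀ X V) (j : Fin M) :
    (X j.succ, V j.succ) = (x₀, v₀) + h • ∑ k, weight e (e j) k •
      field f (X k.succ, V k.succ) := by
  have h1 := congrFun hX.fst_eq j.succ
  have h2 := congrFun hX.2 j.succ
  simp only [Pi.add_apply, Pi.smul_apply, act_Q_succ] at h1 h2
  refine Prod.ext ?_ ?_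
  · simp only [Prod.fst_add, Prod.smul_fst, Prod.fst_sum, field]
    exact h1
  · simp only [Prod.snd_add, Prod.smul_snd, Prod.snd_sum, field]
    exact h2

theorem IsCollocationSolution.stepEnd_eq (hX : IsCollocationSolution e f h x₀ v₀ X V) :
    stepEnd e h x₀ v₀ (force f X V) = (x₀, v₀) + h • ∑ k, weight e 1 k •
      field f (X k.succ, V k.succ) := by
  refine Prod.ext ?_ ?_
  · simp only [stepEnd, Prod.fst_add, Prod.smul_fst, Prod.fst_sum, field]
    rw [← sum_q_smul V, sum_vecMul_smul]
    have : ∑ m, q e m • V m = ∑ m, q e m • v₀ + h • ∑ m, q e m • act (Q e) (force f X V) m := by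
      nth_rewrite 1 [hX.2]
      simp only [Pi.add_apply, Pi.smul_apply, smul_add, Finset.sum_add_distrib, Finset.smul_sum]
      congr 1
      exact Finset.sum_congr rfl fun m _ => smul_comm _ _ _
    rw [this, smul_add, smul_smul, ← sq h, add_assoc]
  · simp only [stepEnd, Prod.snd_add, Prod.smul_snd, Prod.snd_sum, field]
    rw [sum_q_smul]
    rfl

end FirstOrder

/-! ### Accumulation of local errors -/

section Global

/-- A discrete Gronwall estimate, where the recursion is only known for errors at most `1`. -/
theorem discrete_gronwall {E : ℕ → ℝ} {C D h τ : ℝ} {r : ℕ} (hC : 0 < C) (hD : 0 ≤ D)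
    (h0 : 0 < h) (hsmall : D / C * Real.exp (C * τ) * h ^ r ≤ 1) (hE0 : E 0 = 0)
    (hE : ∀ n : ℕ, (n + 1 : ℝ) * h ≤ τ → E n ≤ 1 →
      E (n + 1) ≤ (1 + C * h) * E n + D * h ^ (r + 1)) (n : ℕ) (hn : n * h ≤ τ) :
    E n ≤ D / C * Real.exp (C * τ) * h ^ r := by
  have hexp : ∀ n : ℕ, n * h ≤ τ → ((1 + C * h) ^ n - 1) * (D / C * h ^ r) ≤
      D / C * Real.exp (C * τ) * h ^ r := by
    intro n hn
    have h1 : (1 + C * h) ^ n ≤ Real.exp (C * τ) := by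
      calc (1 + C * h) ^ n ≤ Real.exp (C * h) ^ n := by
            gcongr
            rw [add_comm]
            exact Real.add_one_le_exp _
        _ = Real.exp (C * (n * h)) := by rw [← Real.exp_nat_mul]; congr 1; ring
        _ ≤ Real.exp (C * τ) := by gcongr
    calc _ ≤ Real.exp (C * τ) * (D / C * h ^ r) := by
          gcongr
          linarith
      _ = _ := by ring
  -- The right-hand side solves the recursion with equality and zero initial value.
  have key : E n ≤ ((1 + C * h) ^ n - 1) * (D / C * h ^ r) := by
    induction n with
    | zero => simp [hE0]
    | succ n ih =>
      push_cast at hn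
      have hn' : n * h ≤ τ := by linarith
      have h1 := ih hn'
      -- The bound already proved for `n` is at most `1` by `hsmall`, which licenses the next use of
      -- the recursion.
      have h2 := hE n hn (h1.trans ((hexp n hn').trans hsmall))
      calc E (n + 1) ≤ (1 + C * h) * (((1 + C * h) ^ n - 1) * (D / C * h ^ r)) +
            D * h ^ (r + 1) := h2.trans (by gcongr)
        _ = _ := by
          have hDC : D = C * (D / C) := by field_simp
          generalize D / C = c at hDC ⊢
          rw [hDC]
          ring
  exact key.trans (hexp n hn)

variable {M d : ℕ} {e : Fin M → ℝ} {f : Vec d × Vec d → Vec d} {L : NNReal}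

theorem convergesWithOrder_of_forceOrder (he : StrictMono e) (he01 : ∀ j, e j ∈ Icc (0 : ℝ) 1)
    {p : ℕ} (hp : 0 < p) (hquad : QuadratureOrder e p) (hf : LipschitzWith L f)
    {t₀ T : ℝ} (hT : t₀ < T) {x v : ℝ → Vec d} (hsol : IsSolution f t₀ T x v)
    (hreg : ContDiffOn ℝ p (fun t => f (x t, v t)) (Icc t₀ T))
    (hsmooth : M + 1 < p → ∃ U : Set (Vec d × Vec d), IsOpen U ∧
      (∀ t ∈ Icc t₀ T, (x t, v t) ∈ U) ∧ ContDiffOn ℝ p f U)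
    {S : Starter M d} {k s : ℕ} (hs : 0 < s) (hF : ForceOrder e f k S s) :
    ConvergesWithOrder e f k S t₀ T x v (min p s) := by
  set u : ℝ → Vec d × Vec d := fun t => (x t, v t) with hudef
  have hu : ∀ t ∈ Icc t₀ T, HasDerivWithinAt u (field f (u t)) (Icc t₀ T) t := fun t ht =>
    (hsol t ht).1.prodMk (hsol t ht).2
  have hvreg : ContDiffOn ℝ p v (Icc t₀ T) :=
    (contDiffOn_succ_of_hasDerivWithinAt hT (fun t ht => (hsol t ht).2) hreg).of_le
      (by norm_cast; omega)
  obtain ⟨C₁, h₁, hh₁, hloc⟩ := collocation_local_error (G := field f) (u := u) he he01 hquad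
    (lipschitzWith_field hf) hT hu (hvreg.prodMk hreg) (fun hM => by
      obtain ⟨U, hU, hxU, hfU⟩ := hsmooth hM
      exact ⟨U, hU, hxU, contDiff_snd.contDiffOn.prodMk hfU⟩)
  obtain ⟨R, hR⟩ := isCompact_Icc.exists_bound_of_continuousOn
    (fun t ht => (hu t ht).continuousWithinAt : ContinuousOn u (Icc t₀ T))
  -- The force estimate is only locally uniform. The radius `R + 1` covers all numerical values
  -- within distance `1` of the solution curve.
  obtain ⟨C₂, h₂, hC₂, hh₂, hforce⟩ := hF (R + 1)
  obtain ⟨h₃, hh₃, hsm⟩ := exists_smallStep e L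
  have hE := endSum_nonneg e
  set r := min p s with hr
  have hr0 : r ≠ 0 := by omega
  -- The summand `1` only ensures `0 < C`, as `C` is a divisor in the Gronwall bound.
  set C : ℝ := endSum e * (1 + 2 * L * (1 + entrySum (Q e))) + 1 with hCdef
  have hC : 0 < C := by
    have := entrySum_nonneg (Q e)
    positivity
  set D : ℝ := |C₁| + endSum e * C₂ with hDdef
  have hD : 0 ≤ D := by positivity
  set B : ℝ := D / C * Real.exp (C * (T - t₀)) with hB
  have hB0 : 0 ≤ B := by positivity
  refine ⟨B, min (min h₁ h₂) (min h₃ (1 / (B + 1))),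
    lt_min (lt_min hh₁ hh₂) (lt_min hh₃ (by positivity)), fun h h0 hh => ?_⟩
  simp only [le_min_iff] at hh
  obtain ⟨⟨hh1, hh2⟩, hh3, hh4⟩ := hh
  have hss := hsm h h0 hh3
  refine ⟨existsUnique_isRun hf hss S _ _, fun w hw n hn => ?_⟩
  -- Positivity of the order `r` enters here: `h ^ r ≤ h ≤ 1 / (B + 1)` keeps the run within
  -- distance `1` of the solution.
  have hsmall : B * h ^ r ≤ 1 := by
    rw [le_div_iff₀ (by positivity)] at hh4
    have : h ^ r ≤ h := pow_le_of_le_one h0.le hss.le_one hr0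
    nlinarith
  have hrec : ∀ n : ℕ, (n + 1 : ℝ) * h ≤ T - t₀ → ‖u (t₀ + n * h) - w n‖ ≤ 1 →
      ‖u (t₀ + (n + 1 : ℕ) * h) - w (n + 1)‖ ≤
        (1 + C * h) * ‖u (t₀ + n * h) - w n‖ + D * h ^ (r + 1) := by
    intro n hn hE1
    set t := t₀ + n * h with ht
    have ht0 : t₀ ≤ t := by
      rw [ht]
      have : 0 ≤ n * h := by positivity
      linarith
    have htT : t + h ≤ T := by
      rw [ht]
      linarith
    have htn : t₀ + (n + 1 : ℕ) * h = t + h := by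
      rw [ht]
      push_cast
      ring
    obtain ⟨X, V, hXV⟩ := exists_isCollocationSolution hf hss (x t) (v t)
    obtain ⟨Y, Z, hYZ⟩ := exists_isCollocationSolution hf hss (w n).1 (w n).2
    have e1 := hloc h h0 hh1 t ht0 htT (fun j => (X j.succ, V j.succ)) hXV.node_eq
    have e2 := collocation_step_lipschitz hf hss hXV hYZ
    have hwn : ‖w n‖ ≤ R + 1 := by
      have h1 := hR t ⟨ht0, by linarith⟩
      have h2 : ‖w n‖ ≤ ‖u t‖ + ‖u t - w n‖ := by
        have := norm_sub_le (u t) (u t - w n)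
        rwa [sub_sub_cancel] at this
      linarith
    obtain ⟨X', V', hX', hV', hit, hend⟩ := isStep_iff.1 (hw.2 n)
    have e3 := hforce h h0 hh2 n (w n).1 (w n).2 ((norm_fst_le (w n)).trans hwn)
      ((norm_snd_le (w n)).trans hwn) Y Z hYZ X' V' hX' hV' hit
    have e4 := norm_stepEnd_sub_le (e := e) h0 hss.le_one (w n).1 (w n).2 (w n).1 (w n).2
      (force f Y Z) (force f (X' k) (V' k))
    rw [sub_self, norm_zero, mul_zero, zero_add, ← hend] at e4
    have e1' : ‖stepEnd e h (x t) (v t) (force f X V) - u (t + h)‖ ≤ |C₁| * h ^ (r + 1) := by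
      rw [hXV.stepEnd_eq]
      refine e1.trans ?_
      calc C₁ * h ^ (p + 1) ≤ |C₁| * h ^ (p + 1) := by
            gcongr
            exact le_abs_self C₁
        _ ≤ |C₁| * h ^ (r + 1) := by
            refine mul_le_mul_of_nonneg_left ?_ (abs_nonneg _)
            exact pow_le_pow_of_le_one h0.le hss.le_one (by omega)
    have e4' : ‖stepEnd e h (w n).1 (w n).2 (force f Y Z) - w (n + 1)‖ ≤
        endSum e * C₂ * h ^ (r + 1) := by
      have hpow : h ^ s ≤ h ^ r := pow_le_pow_of_le_one h0.le hss.le_one (by omega)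
      calc _ ≤ h * endSum e * (C₂ * h ^ s) := e4.trans (by gcongr)
        _ ≤ h * endSum e * (C₂ * h ^ r) := by gcongr
        _ = _ := by ring
    have e2' : ‖stepEnd e h (x t) (v t) (force f X V) -
        stepEnd e h (w n).1 (w n).2 (force f Y Z)‖ ≤ (1 + C * h) * ‖u t - w n‖ := by
      refine e2.trans (mul_le_mul_of_nonneg_right ?_ (norm_nonneg _))
      rw [hCdef]
      nlinarith
    rw [htn]
    -- Three contributions: the local collocation error from the exact point, the propagation of the
    -- earlier error by the collocation step, and the iteration error of SDC from the numerical
    -- point.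
    have hsplit : u (t + h) - w (n + 1) =
        -(stepEnd e h (x t) (v t) (force f X V) - u (t + h)) +
        (stepEnd e h (x t) (v t) (force f X V) - stepEnd e h (w n).1 (w n).2 (force f Y Z)) +
        (stepEnd e h (w n).1 (w n).2 (force f Y Z) - w (n + 1)) := by abel
    rw [hsplit]
    refine norm_add₃_le.trans ?_
    rw [norm_neg, hDdef]
    linarith
  have hfinal := discrete_gronwall (E := fun n => ‖u (t₀ + n * h) - w n‖) hC hD h0 hsmall
    (by simp [hw.1, hudef]) hrec n (by linarith)
  exact ⟨(norm_fst_le _).trans hfinal, (norm_snd_le _).trans hfinal⟩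

end Global

end SDC

theorem theorem4p2 {M d : ℕ} (e : Fin M → ℝ) (he : StrictMono e)
    (he01 : ∀ j, e j ∈ Set.Icc (0 : ℝ) 1)
    (p : ℕ) (hp : 0 < p) (hquad : SDC.QuadratureOrder e p)
    (f : SDC.Vec d × SDC.Vec d → SDC.Vec d) (L : NNReal) (hf : LipschitzWith L f)
    (t₀ T : ℝ) (hT : t₀ < T) (x v : ℝ → SDC.Vec d) (hsol : SDC.IsSolution f t₀ T x v)
    (hreg : ContDiffOn ℝ p (fun t => f (x t, v t)) (Set.Icc t₀ T))
    (hsmooth : M + 1 < p → ∃ U : Set (SDC.Vec d × SDC.Vec d), IsOpen U ∧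
      (∀ t ∈ Set.Icc t₀ T, (x t, v t) ∈ U) ∧ ContDiffOn ℝ p f U)
    (S : SDC.Starter M d) (k k₀ : ℕ) (hk : 0 < k + k₀) (hS : SDC.StarterOrder e f S k₀) :
    SDC.ConvergesWithOrder e f k S t₀ T x v (min p (k + k₀)) ∧
    ((∀ y w w', f (y, w) = f (y, w')) →
      SDC.ConvergesWithOrder e f k S t₀ T x v (min p (2 * k + k₀))) :=
  ⟨SDC.convergesWithOrder_of_forceOrder he he01 hp hquad hf hT hsol hreg hsmooth hk
      (hS.forceOrder hf k),
    fun hind => SDC.convergesWithOrder_of_forceOrder he he01 hp hquad hf hT hsol hreg hsmooth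
      (by omega) (hS.forceOrder_of_indep hf hind k)⟩
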